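/- Let $N\ge 0$ be an integer, $0=a_0<a_1<\dots<a_N<a_{N+1}=\ell$, $\ell_j=a_{j+1}-a_j$ for $j=0,\dots,N$, let $M_1,\dots,M_N>0$, and for each $j=0,\dots,N$ let $q_j$ be a continuous real-valued function on $[a_j,a_{j+1}]$. Consider the eigenvalue problem \begin{align*} -\varphi''(x)+q_j(x)\varphi(x)&=\lambda^2\varphi(x),\quad x\in(a_j,a_{j+1}),\ j=0,\dots,N,\\ \varphi(0)=\varphi(\ell)&=0,\\ \varphi(a_j^-)&=\varphi(a_j^+),\quad j=1,\dots,N,\\ \varphi'(a_j^+)&=\varphi'(a_j^-)-M_j\lambda^2\varphi(a_j),\quad j=1,\dots,N, \end{align*} where $\lambda^2\in\mathbb C$ is called an eigenvalue if there is a complex-valued solution $\varphi\not\equiv0$. The eigenvalues are all real and form a strictly increasing sequence $\lambda_1^2<\lambda_2^2<\cdots$. For $n\ge1$ let $\lambda_n=\sqrt{\lambda_n^2}$ if $\lambda_n^2\ge0$ and $\lambda_n=i\sqrt{|\lambda_n^2|}$ if $\lambda_n^2<0$, and let $\lambda_{-n}=-\lambda_n$; let $\Lambda=\{\lambda_n\}_{n\in\mathbb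 Z\setminus\{0\}}$ be the resulting family of eigenfrequencies (if $0$ is an eigenvalue, the eigenfrequency $0$ is counted twice). Let $\Lambda'$ be any subfamily of $\Lambda$ obtained by deleting $2N$ members. Then $\Lambda'$ can be reparametrized, one-to-one, as $$\Lambda'=\bigcup_{j=0}^N\{\lambda_m^{(j)}\}_{m\in\mathbb Z\setminus\{0\}},$$ where for each $j=0,\dots,N$ there is a constant $C$ such that $$\left|\lambda_m^{(j)}-\frac{\pi m}{\ell_j}\right|\le\frac{C}{|m|}\qquad\text{for all } m\in\mathbb Z\setminus\{0\}.$$ -/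

import Mathlib

namespace LoadedString

/-- The nonzero integers, which index the eigenfrequencies and each of the split sequences. -/
abbrev NonzeroInt : Type := {m : ℤ // m ≠ 0}

/-- The length `ℓ_j = a_{j+1} - a_j` of the `j`-th subinterval, `j = 0, …, N`. -/
def len {N : ℕ} (a : Fin (N + 2) → ℝ) (j : Fin (N + 1)) : ℝ :=
  a j.succ - a j.castSucc

/-- `φ` solves the Sturm–Liouville system with spectral parameter `μ` (written `λ ^ 2` in the usual
notation), Dirichlet conditions at both ends, and point masses at the interior nodes.
The nodes are `a 0 < a 1 < … < a (N + 1)`, the potential on `(a j, a (j + 1))` is `q j`, and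
`M j`, for `j : Fin N`, is the mass attached at the interior node with number `j + 1`. -/
structure IsSolution {N : ℕ} (a : Fin (N + 2) → ℝ) (M : Fin N → ℝ) (q : Fin (N + 1) → ℝ → ℝ)
    (μ : ℂ) (φ : ℝ → ℂ) : Prop where
  /-- Continuity on the whole interval, in particular at the masses. -/
  continuousOn : ContinuousOn φ (Set.Icc (a 0) (a (Fin.last (N + 1))))
  /-- `φ` is differentiable inside each subinterval. -/
  differentiableAt : ∀ j : Fin (N + 1), ∀ x ∈ Set.Ioo (a j.castSucc) (a j.succ),
    DifferentiableAt ℝ φ x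
  /-- `-φ'' + q φ = μ φ` inside each subinterval. -/
  equation : ∀ j : Fin (N + 1), ∀ x ∈ Set.Ioo (a j.castSucc) (a j.succ),
    HasDerivAt (deriv φ) ((q j x : ℂ) * φ x - μ * φ x) x
  /-- Dirichlet condition at the left end. -/
  left_end : φ (a 0) = 0
  /-- Dirichlet condition at the right end. -/
  right_end : φ (a (Fin.last (N + 1))) = 0
  /-- The one-sided limits of `φ'` at each mass exist and
  `φ'(a_j⁺) = φ'(a_j⁻) - M_j μ φ(a_j)`. -/
  jump : ∀ j : Fin N, ∃ dl dr : ℂ,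
    Filter.Tendsto (deriv φ) (nhdsWithin (a j.succ.castSucc) (Set.Iio (a j.succ.castSucc)))
      (nhds dl) ∧
    Filter.Tendsto (deriv φ) (nhdsWithin (a j.succ.castSucc) (Set.Ioi (a j.succ.castSucc)))
      (nhds dr) ∧
    dr = dl - (M j : ℂ) * μ * φ (a j.succ.castSucc)

/-- The set of all (a priori complex) eigenvalues `μ = λ ^ 2` of the system. -/
def eigenvalues {N : ℕ} (a : Fin (N + 2) → ℝ) (M : Fin N → ℝ) (q : Fin (N + 1) → ℝ → ℝ) :
    Set ℂ :=
  {μ | ∃ φ : ℝ → ℂ, IsSolution a M q μ φ ∧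
    ∃ x ∈ Set.Icc (a 0) (a (Fin.last (N + 1))), φ x ≠ 0}

/-- The square root of a real number in the closed upper half plane: `√μ` if `μ ≥ 0` and
`i √|μ|` if `μ < 0`. -/
noncomputable def rootOf (μ : ℝ) : ℂ :=
  if 0 ≤ μ then (Real.sqrt μ : ℂ) else Complex.I * (Real.sqrt |μ| : ℂ)

/-- The eigenfrequencies `λ_n`, `n = ±1, ±2, …`, of a list `μ 0 < μ 1 < …` of eigenvalues:
for `n ≥ 1`, `λ_n` is the square root of the `n`-th eigenvalue, which is `μ (n - 1)`,
and `λ_{-n} = -λ_n`. An eigenvalue `0` thus gives two eigenfrequencies `λ_n = λ_{-n} = 0`. -/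
noncomputable def eigenfrequency (μ : ℕ → ℝ) (n : NonzeroInt) : ℂ :=
  if 0 < n.1 then rootOf (μ (n.1.natAbs - 1)) else -rootOf (μ (n.1.natAbs - 1))

end LoadedString

/-! The proof counts eigenvalues with Prüfer angles. Write a real solution as `(φ, φ') = ρ (sin θ,
cos θ)`. The angle obeys a first order equation on each subinterval, and a mass acts like a unit
time of the same kind of equation with `A = 0`. Starting from `θ = 0`, the angle `totalAngle` at the
right end is a continuous, strictly increasing function of `μ`. It is always positive, falls below
`π` for some `μ`, and is unbounded. Eigenvalues are real by a Wronskian argument, and they are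
exactly the zeros of the sine of `totalAngle`. So the eigenvalue of index `n ≥ 0` is the place where
`totalAngle` equals `(n + 1) π`.

For the asymptotics put `μ = k²` and pass to the angle `ψ` with `tan ψ = k tan θ`, which agrees with
`θ` at multiples of `π`. Across a subinterval `ψ` grows by `k ℓ_j + O(1/k)`. A mass never carries
`ψ` across a multiple of `π`, but it carries a `ψ` that is not within `O(1/k)` above a multiple of
`π` to within `O(1/k)` of the next one. Hence `totalAngle` is bounded on both sides by the number of
half-waves fitting into the separate subintervals, plus one extra `π` per mass
(`exists_totalAngle_lt`, `exists_le_totalAngle`).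

Consequently, once the first `N` eigenvalues are dropped, the square roots follow the sorted union
of the clamped frequencies `π m / ℓ_j` with error `O(1/m)` (`exists_abs_sqrt_sub_le`). Undoing the
sorting splits the eigenfrequencies into `N + 1` sequences. Another choice of `2N` deleted members
changes only finitely many terms, which the constants absorb (`exists_reparametrization`). -/

namespace LoadedString

open Set Filter Topology

/-! ### Prüfer angles: existence and comparison -/

/-- `θ` is a Prüfer angle on `[s, t]` for the system `y₁' = A y₂`, `y₂' = -p y₁`. -/
def IsAngle (A : ℝ) (p : ℝ → ℝ) (s t : ℝ) (θ : ℝ → ℝ) : Prop :=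
  ∀ x ∈ Icc s t, HasDerivAt θ (A * Real.cos (θ x) ^ 2 + p x * Real.sin (θ x) ^ 2) x

/-- The field is `A + (p - A) sin² θ`, and `sin² θ₂ - sin² θ₁ = sin (θ₂ + θ₁) sin (θ₂ - θ₁)`. -/
theorem abs_angleField_sub_le (A p θ₁ θ₂ : ℝ) :
    |(A * Real.cos θ₂ ^ 2 + p * Real.sin θ₂ ^ 2) - (A * Real.cos θ₁ ^ 2 + p * Real.sin θ₁ ^ 2)| ≤
      |p - A| * |θ₂ - θ₁| := by
  have h : (A * Real.cos θ₂ ^ 2 + p * Real.sin θ₂ ^ 2) -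
      (A * Real.cos θ₁ ^ 2 + p * Real.sin θ₁ ^ 2) =
      (p - A) * (Real.sin (θ₂ + θ₁) * Real.sin (θ₂ - θ₁)) := by
    rw [Real.sin_add, Real.sin_sub]
    have h1 := Real.sin_sq_add_cos_sq θ₁
    have h2 := Real.sin_sq_add_cos_sq θ₂
    have e1 : Real.cos θ₁ ^ 2 = 1 - Real.sin θ₁ ^ 2 := by linarith
    have e2 : Real.cos θ₂ ^ 2 = 1 - Real.sin θ₂ ^ 2 := by linarith
    linear_combination A * e2 - A * e1 - (p - A) * (Real.sin θ₂ ^ 2 * e1 - Real.sin θ₁ ^ 2 * e2)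
  rw [h, abs_mul, abs_mul]
  have h1 : |Real.sin (θ₂ + θ₁)| ≤ 1 := Real.abs_sin_le_one _
  have h2 : |Real.sin (θ₂ - θ₁)| ≤ |θ₂ - θ₁| := Real.abs_sin_le_abs
  gcongr
  calc |Real.sin (θ₂ + θ₁)| * |Real.sin (θ₂ - θ₁)| ≤ 1 * |θ₂ - θ₁| := by gcongr
    _ = _ := one_mul _

theorem exists_isAngle (A : ℝ) {p : ℝ → ℝ} (hp : Continuous p) {s t : ℝ} (hst : s ≤ t) (α : ℝ) :
    ∃ θ : ℝ → ℝ, θ s = α ∧ IsAngle A p s t θ := by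
  obtain ⟨B, hB⟩ := (isCompact_Icc (a := s - 1) (b := t + 1)).exists_bound_of_continuousOn
    hp.continuousOn
  have hB0 : 0 ≤ B := (norm_nonneg _).trans (hB s ⟨by linarith, by linarith⟩)
  let f : ℝ → ℝ → ℝ := fun x θ => A * Real.cos θ ^ 2 + p x * Real.sin θ ^ 2
  have hL : 0 ≤ |A| + B := by positivity
  have hmem : s ∈ Icc (s - 1) (t + 1) := ⟨by linarith, by linarith⟩
  have hmul : 0 ≤ (|A| + B) * max (t + 1 - s) (s - (s - 1)) := by
    apply mul_nonneg hL
    apply le_max_of_le_right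
    linarith
  -- The field is bounded and globally Lipschitz in `θ`, so a large enough ball makes the length
  -- condition automatic. The interval is widened by `1` on both sides to get two-sided derivatives
  -- at `s` and `t`.
  have hpl : IsPicardLindelof f (tmin := s - 1) (tmax := t + 1) ⟨s, hmem⟩ α
      ⟨(|A| + B) * max (t + 1 - s) (s - (s - 1)), hmul⟩ 0 ⟨|A| + B, hL⟩ ⟨|A| + B, hL⟩ := by
    refine ⟨?_, ?_, ?_, ?_⟩
    · intro x hx
      apply LipschitzOnWith.of_dist_le_mul
      intro θ₂ _ θ₁ _
      rw [Real.dist_eq, Real.dist_eq]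
      refine (abs_angleField_sub_le A (p x) θ₁ θ₂).trans ?_
      have h1 : |p x - A| ≤ |p x| + |A| := abs_sub _ _
      have h2 : |p x| ≤ B := hB x hx
      change |p x - A| * |θ₂ - θ₁| ≤ (|A| + B) * |θ₂ - θ₁|
      gcongr
      linarith
    · intro θ _
      simp only [f]
      fun_prop
    · intro x hx θ _
      change |A * Real.cos θ ^ 2 + p x * Real.sin θ ^ 2| ≤ |A| + B
      have h2 : |p x| ≤ B := hB x hx
      have hc : Real.cos θ ^ 2 ≤ 1 := Real.cos_sq_le_one θ
      have hs : Real.sin θ ^ 2 ≤ 1 := Real.sin_sq_le_one θ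
      refine (abs_add_le _ _).trans ?_
      rw [abs_mul, abs_mul, abs_of_nonneg (sq_nonneg (Real.cos θ)),
        abs_of_nonneg (sq_nonneg (Real.sin θ))]
      calc _ ≤ |A| * 1 + B * 1 := by gcongr
        _ = _ := by ring
    · change (|A| + B) * max (t + 1 - s) (s - (s - 1)) ≤
        (|A| + B) * max (t + 1 - s) (s - (s - 1)) - 0
      rw [sub_zero]
  obtain ⟨θ, h0, h⟩ := hpl.exists_eq_forall_mem_Icc_hasDerivWithinAt₀
  refine ⟨θ, h0, fun x hx => ?_⟩
  exact (h x ⟨by linarith [hx.1], by linarith [hx.2]⟩).hasDerivAt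
    (Icc_mem_nhds (by linarith [hx.1]) (by linarith [hx.2]))

/-- A solution of `d' = g d + h` with `h ≥ 0` becomes monotone after multiplication by the
integrating factor. -/
theorem exists_integratingFactor {g h d : ℝ → ℝ} {s t : ℝ} (hst : s ≤ t)
    (hg : ContinuousOn g (Icc s t)) (hd : ∀ x ∈ Icc s t, HasDerivAt d (g x * d x + h x) x)
    (hh : ∀ x ∈ Icc s t, 0 ≤ h x) :
    ∃ E : ℝ → ℝ, (∀ x, 0 < E x) ∧ MonotoneOn (fun x => E x * d x) (Icc s t) := by
  -- The continuous extension gives an integral that is differentiable on both sides at the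
  -- endpoints too.
  let G : ℝ → ℝ := IccExtend hst ((Icc s t).domRestrict g)
  have hG : Continuous G := hg.domRestrict.Icc_extend'
  have hGg : ∀ x ∈ Icc s t, G x = g x := fun x hx => by
    simp only [G]
    rw [IccExtend_of_mem hst _ hx]; rfl
  let E : ℝ → ℝ := fun x => Real.exp (-∫ y in s..x, G y)
  have hE : ∀ x, HasDerivAt E (E x * (-G x)) x := fun x =>
    ((hG.integral_hasStrictDerivAt s x).hasDerivAt.neg).exp
  have hEd : ∀ x ∈ Icc s t, HasDerivAt (fun x => E x * d x) (E x * h x) x := by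
    intro x hx
    refine ((hE x).mul (hd x hx)).congr_deriv ?_
    rw [hGg x hx]; ring
  refine ⟨E, fun x => Real.exp_pos _, ?_⟩
  apply monotoneOn_of_hasDerivWithinAt_nonneg (convex_Icc s t) (f' := fun x => E x * h x)
  · exact fun x hx => (hEd x hx).continuousAt.continuousWithinAt
  · exact fun x hx => (hEd x (interior_subset hx)).hasDerivWithinAt
  · exact fun x hx => mul_nonneg (Real.exp_pos _).le (hh x (interior_subset hx))

/-- Comparison of two functions whose defects in the Prüfer equation are ordered. -/
theorem exists_monotoneOn_mul_sub {A s t : ℝ} {p θ₁ θ₂ D₁ D₂ : ℝ → ℝ} (hst : s ≤ t)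
    (hp : ContinuousOn p (Icc s t)) (h₁ : ∀ x ∈ Icc s t, HasDerivAt θ₁ (D₁ x) x)
    (h₂ : ∀ x ∈ Icc s t, HasDerivAt θ₂ (D₂ x) x)
    (h : ∀ x ∈ Icc s t, D₁ x - (A * Real.cos (θ₁ x) ^ 2 + p x * Real.sin (θ₁ x) ^ 2) ≤
      D₂ x - (A * Real.cos (θ₂ x) ^ 2 + p x * Real.sin (θ₂ x) ^ 2)) :
    ∃ E : ℝ → ℝ, (∀ x, 0 < E x) ∧ MonotoneOn (fun x => E x * (θ₂ x - θ₁ x)) (Icc s t) := by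
  have c₁ : ContinuousOn θ₁ (Icc s t) := fun x hx => (h₁ x hx).continuousAt.continuousWithinAt
  have c₂ : ContinuousOn θ₂ (Icc s t) := fun x hx => (h₂ x hx).continuousAt.continuousWithinAt
  -- `sinc` turns the difference of the two fields into a continuous coefficient times `θ₂ - θ₁`,
  -- even where the angles meet.
  have key : ∀ x, Real.sin (θ₂ x - θ₁ x) = Real.sinc (θ₂ x - θ₁ x) * (θ₂ x - θ₁ x) := by
    intro x
    by_cases hx : θ₂ x - θ₁ x = 0
    · simp [hx]
    · rw [Real.sinc_of_ne_zero hx]; field_simp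
  refine exists_integratingFactor (d := fun x => θ₂ x - θ₁ x)
    (g := fun x => (p x - A) * Real.sin (θ₂ x + θ₁ x) * Real.sinc (θ₂ x - θ₁ x))
    (h := fun x => (D₂ x - (A * Real.cos (θ₂ x) ^ 2 + p x * Real.sin (θ₂ x) ^ 2)) -
      (D₁ x - (A * Real.cos (θ₁ x) ^ 2 + p x * Real.sin (θ₁ x) ^ 2))) hst ?_ ?_ ?_
  · exact ((hp.sub continuousOn_const).mul (Real.continuous_sin.comp_continuousOn (c₂.add c₁))).mul
      (Real.continuous_sinc.comp_continuousOn (c₂.sub c₁))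
  · intro x hx
    refine ((h₂ x hx).sub (h₁ x hx)).congr_deriv ?_
    have hk := key x
    rw [Real.sin_sub] at hk
    rw [Real.sin_add]
    have e1 : Real.cos (θ₁ x) ^ 2 = 1 - Real.sin (θ₁ x) ^ 2 := by
      linarith [Real.sin_sq_add_cos_sq (θ₁ x)]
    have e2 : Real.cos (θ₂ x) ^ 2 = 1 - Real.sin (θ₂ x) ^ 2 := by
      linarith [Real.sin_sq_add_cos_sq (θ₂ x)]
    linear_combination (p x - A) * (Real.sin (θ₂ x) * Real.cos (θ₁ x) +
      Real.cos (θ₂ x) * Real.sin (θ₁ x)) * hk - A * e1 + A * e2 -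
      (p x - A) * (Real.sin (θ₂ x) ^ 2 * e1 - Real.sin (θ₁ x) ^ 2 * e2)
  · intro x hx
    linarith [h x hx]

section Comparison

variable {A s t : ℝ} {p θ₁ θ₂ D₁ D₂ : ℝ → ℝ}

/-- The functions need not be Prüfer angles: only their defects are compared, so constants can serve
as barriers. -/
theorem angle_le_of_defect_le (hst : s ≤ t)
    (hp : ContinuousOn p (Icc s t)) (h₁ : ∀ x ∈ Icc s t, HasDerivAt θ₁ (D₁ x) x)
    (h₂ : ∀ x ∈ Icc s t, HasDerivAt θ₂ (D₂ x) x)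
    (h : ∀ x ∈ Icc s t, D₁ x - (A * Real.cos (θ₁ x) ^ 2 + p x * Real.sin (θ₁ x) ^ 2) ≤
      D₂ x - (A * Real.cos (θ₂ x) ^ 2 + p x * Real.sin (θ₂ x) ^ 2))
    (hs : θ₁ s ≤ θ₂ s) : θ₁ t ≤ θ₂ t := by
  obtain ⟨E, hE, hm⟩ := exists_monotoneOn_mul_sub hst hp h₁ h₂ h
  have h1 := hm (left_mem_Icc.2 hst) (right_mem_Icc.2 hst) hst
  have h2 : 0 ≤ E t * (θ₂ t - θ₁ t) := le_trans (mul_nonneg (hE s).le (sub_nonneg.2 hs)) h1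
  exact sub_nonneg.1 ((mul_nonneg_iff_of_pos_left (hE t)).1 h2)

/-- A monotone function that starts nonnegative and ends nonpositive vanishes. Strict inequalities
below are obtained by contradiction from this rigidity. -/
theorem angle_eqOn_of_defect_le (hst : s ≤ t)
    (hp : ContinuousOn p (Icc s t)) (h₁ : ∀ x ∈ Icc s t, HasDerivAt θ₁ (D₁ x) x)
    (h₂ : ∀ x ∈ Icc s t, HasDerivAt θ₂ (D₂ x) x)
    (h : ∀ x ∈ Icc s t, D₁ x - (A * Real.cos (θ₁ x) ^ 2 + p x * Real.sin (θ₁ x) ^ 2) ≤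
      D₂ x - (A * Real.cos (θ₂ x) ^ 2 + p x * Real.sin (θ₂ x) ^ 2))
    (hs : θ₁ s ≤ θ₂ s) (ht : θ₂ t ≤ θ₁ t) : EqOn θ₁ θ₂ (Icc s t) := by
  obtain ⟨E, hE, hm⟩ := exists_monotoneOn_mul_sub hst hp h₁ h₂ h
  intro x hx
  have h1 := hm (left_mem_Icc.2 hst) hx hx.1
  have h2 := hm hx (right_mem_Icc.2 hst) hx.2
  have h3 : 0 ≤ E s * (θ₂ s - θ₁ s) := mul_nonneg (hE s).le (sub_nonneg.2 hs)
  have h4 : E t * (θ₂ t - θ₁ t) ≤ 0 := mul_nonpos_of_nonneg_of_nonpos (hE t).le (sub_nonpos.2 ht)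
  have h5 : E x * (θ₂ x - θ₁ x) = 0 := le_antisymm (h2.trans h4) (h3.trans h1)
  rcases mul_eq_zero.1 h5 with h6 | h6
  · exact absurd h6 (hE x).ne'
  · linarith

end Comparison

/-! ### The angle as a function of its initial value and of the spectral parameter -/

/-- The end value at `t` of the Prüfer angle with value `α` at `s`. -/
noncomputable def angle (A : ℝ) (p : ℝ → ℝ) (s t α : ℝ) : ℝ → ℝ :=
  Classical.epsilon fun θ : ℝ → ℝ => θ s = α ∧ IsAngle A p s t θ

section Angle

variable (A : ℝ) {p p₁ p₂ : ℝ → ℝ} {s t : ℝ} (α : ℝ)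

theorem angle_spec (hp : Continuous p) (hst : s ≤ t) :
    angle A p s t α s = α ∧ IsAngle A p s t (angle A p s t α) :=
  Classical.epsilon_spec (exists_isAngle A hp hst α)

theorem angle_left (hp : Continuous p) (hst : s ≤ t) : angle A p s t α s = α :=
  (angle_spec A α hp hst).1

theorem isAngle_angle (hp : Continuous p) (hst : s ≤ t) : IsAngle A p s t (angle A p s t α) :=
  (angle_spec A α hp hst).2

variable {A α}

theorem IsAngle.continuousOn {θ : ℝ → ℝ} (h : IsAngle A p s t θ) : ContinuousOn θ (Icc s t) :=
  fun x hx => (h x hx).continuousAt.continuousWithinAt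

theorem IsAngle.le {θ₁ θ₂ : ℝ → ℝ} (h₁ : IsAngle A p₁ s t θ₁) (h₂ : IsAngle A p₂ s t θ₂)
    (hst : s ≤ t) (hp : Continuous p₁) (hle : ∀ x, p₁ x ≤ p₂ x) (hs : θ₁ s ≤ θ₂ s) :
    θ₁ t ≤ θ₂ t := by
  refine angle_le_of_defect_le (A := A) hst hp.continuousOn h₁ h₂ (fun x _ => ?_) hs
  have := mul_le_mul_of_nonneg_right (hle x) (sq_nonneg (Real.sin (θ₂ x)))
  linarith

/-- With `A = 1`, the equation forces `θ' = 1` wherever `sin θ = 0`, so the sine cannot vanish on an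
interval. -/
theorem IsAngle.exists_sin_ne_zero {θ : ℝ → ℝ} (h : IsAngle 1 p s t θ) (hst : s < t) :
    ∃ x ∈ Ioo s t, Real.sin (θ x) ≠ 0 := by
  by_contra hcon
  push Not at hcon
  have hm : (s + t) / 2 ∈ Ioo s t := ⟨by linarith, by linarith⟩
  have hz : (fun x => Real.sin (θ x)) =ᶠ[𝓝 ((s + t) / 2)] fun _ => 0 := by
    filter_upwards [Ioo_mem_nhds hm.1 hm.2] with y hy using hcon y hy
  have h3 := (h _ (Ioo_subset_Icc_self hm)).sin.unique
    ((hasDerivAt_const _ (0 : ℝ)).congr_of_eventuallyEq hz)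
  have h4 := Real.sin_sq_add_cos_sq (θ ((s + t) / 2))
  rw [hcon _ hm] at h3 h4
  have h5 : Real.cos (θ ((s + t) / 2)) ^ 2 = 1 := by linarith
  rw [h5] at h3
  have h6 : Real.cos (θ ((s + t) / 2)) = 0 := by linarith
  rw [h6] at h5
  norm_num at h5

/-- Increasing the potential strictly increases the Prüfer angle. -/
theorem IsAngle.lt_of_lt {θ₁ θ₂ : ℝ → ℝ} (h₁ : IsAngle 1 p₁ s t θ₁) (h₂ : IsAngle 1 p₂ s t θ₂)
    (hst : s < t) (hp : Continuous p₁) (hlt : ∀ x, p₁ x < p₂ x) (hs : θ₁ s ≤ θ₂ s) :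
    θ₁ t < θ₂ t := by
  by_contra hcon
  have heq := angle_eqOn_of_defect_le (A := 1) hst.le hp.continuousOn h₁ h₂ (fun x _ => by
    have := mul_le_mul_of_nonneg_right (hlt x).le (sq_nonneg (Real.sin (θ₂ x)))
    linarith) hs (not_lt.1 hcon)
  obtain ⟨x, hx, hne⟩ := h₁.exists_sin_ne_zero hst
  have hx' := Ioo_subset_Icc_self hx
  have hee : θ₁ =ᶠ[𝓝 x] θ₂ := by
    filter_upwards [Icc_mem_nhds hx.1 hx.2] with y hy using heq hy
  have := (h₁ x hx').unique ((h₂ x hx').congr_of_eventuallyEq hee)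
  rw [← heq hx'] at this
  have h0 : (p₂ x - p₁ x) * Real.sin (θ₁ x) ^ 2 = 0 := by linarith
  rcases mul_eq_zero.1 h0 with h0 | h0
  · linarith [hlt x]
  · exact hne (pow_eq_zero_iff two_ne_zero |>.1 h0)

/-- Grönwall: `|p₁ - A|` controls the Lipschitz constant, and changing the potential adds at most
`ε` because `sin² ≤ 1`. -/
theorem IsAngle.abs_sub_le {θ₁ θ₂ : ℝ → ℝ} {K ε : ℝ} (h₁ : IsAngle A p₁ s t θ₁)
    (h₂ : IsAngle A p₂ s t θ₂) (hst : s ≤ t) (hK : 0 < K) (hp : ∀ x ∈ Icc s t, |p₁ x - A| ≤ K)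
    (hε : ∀ x ∈ Icc s t, |p₂ x - p₁ x| ≤ ε) :
    |θ₂ t - θ₁ t| ≤ |θ₂ s - θ₁ s| * Real.exp (K * (t - s)) +
      ε / K * (Real.exp (K * (t - s)) - 1) := by
  have h := norm_le_gronwallBound_of_norm_deriv_right_le (f := fun x => θ₂ x - θ₁ x)
    (f' := fun x => (A * Real.cos (θ₂ x) ^ 2 + p₂ x * Real.sin (θ₂ x) ^ 2) -
      (A * Real.cos (θ₁ x) ^ 2 + p₁ x * Real.sin (θ₁ x) ^ 2)) (δ := |θ₂ s - θ₁ s|) (K := K)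
    (ε := ε) (a := s) (b := t) (h₂.continuousOn.sub h₁.continuousOn)
    (fun x hx => ((h₂ x (Ico_subset_Icc_self hx)).sub
      (h₁ x (Ico_subset_Icc_self hx))).hasDerivWithinAt) le_rfl ?_ t (right_mem_Icc.2 hst)
  · rw [gronwallBound_of_K_ne_0 hK.ne'] at h
    exact h
  · intro x hx
    have hx' := Ico_subset_Icc_self hx
    rw [Real.norm_eq_abs, Real.norm_eq_abs]
    have e : (A * Real.cos (θ₂ x) ^ 2 + p₂ x * Real.sin (θ₂ x) ^ 2) -
        (A * Real.cos (θ₁ x) ^ 2 + p₁ x * Real.sin (θ₁ x) ^ 2) =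
        ((A * Real.cos (θ₂ x) ^ 2 + p₁ x * Real.sin (θ₂ x) ^ 2) -
        (A * Real.cos (θ₁ x) ^ 2 + p₁ x * Real.sin (θ₁ x) ^ 2)) +
        (p₂ x - p₁ x) * Real.sin (θ₂ x) ^ 2 := by ring
    rw [e]
    refine (abs_add_le _ _).trans (add_le_add ?_ ?_)
    · exact (abs_angleField_sub_le _ _ _ _).trans (by gcongr; exact hp x hx')
    · rw [abs_mul, abs_of_nonneg (sq_nonneg (Real.sin (θ₂ x)))]
      calc _ ≤ ε * 1 := by
            gcongr
            · exact (abs_nonneg _).trans (hε x hx')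
            · exact hε x hx'
            · exact Real.sin_sq_le_one _
        _ = ε := mul_one _

/-- The end value of the Prüfer angle depends continuously on a linear spectral parameter. -/
theorem continuous_angle_right {Q : ℝ → ℝ} (hQ : Continuous Q) (B : ℝ) (hst : s ≤ t) {α : ℝ → ℝ}
    (hα : Continuous α) : Continuous fun μ => angle A (fun x => B * μ - Q x) s t (α μ) t := by
  have hc : ∀ μ : ℝ, Continuous fun x => B * μ - Q x := fun μ => continuous_const.sub hQ
  rw [continuous_iff_continuousAt]
  intro μ₀
  obtain ⟨K, hK⟩ := (isCompact_Icc (a := s) (b := t)).exists_bound_of_continuousOn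
    ((hc μ₀).sub (continuous_const (y := A))).continuousOn
  have hK' : (0 : ℝ) < |K| + 1 := by positivity
  rw [ContinuousAt, tendsto_iff_dist_tendsto_zero]
  refine squeeze_zero (g := fun μ => |α μ - α μ₀| * Real.exp ((|K| + 1) * (t - s)) +
      |B * (μ - μ₀)| / (|K| + 1) * (Real.exp ((|K| + 1) * (t - s)) - 1))
    (fun _ => dist_nonneg) (fun μ => ?_) ?_
  · rw [Real.dist_eq]
    have h := (isAngle_angle A (α μ₀) (hc μ₀) hst).abs_sub_le (isAngle_angle A (α μ) (hc μ) hst)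
      (K := |K| + 1) (ε := |B * (μ - μ₀)|) hst hK'
      (fun x hx => (hK x hx).trans (by linarith [le_abs_self K]))
      (fun x _ => le_of_eq (by congr 1; ring))
    rwa [angle_left _ _ (hc μ₀) hst, angle_left _ _ (hc μ) hst] at h
  · have : Continuous fun μ => |α μ - α μ₀| * Real.exp ((|K| + 1) * (t - s)) +
      |B * (μ - μ₀)| / (|K| + 1) * (Real.exp ((|K| + 1) * (t - s)) - 1) := by fun_prop
    have h2 := this.tendsto μ₀
    simpa using h2

end Angle

/-! ### The linear system and its polar form -/

/-- `(y₁, y₂)` solves `y₁' = A y₂`, `y₂' = -p y₁` on `[s, t]`. -/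
def IsLinSol (A : ℝ) (p : ℝ → ℂ) (s t : ℝ) (y₁ y₂ : ℝ → ℂ) : Prop :=
  ∀ x ∈ Icc s t, HasDerivAt y₁ (A * y₂ x) x ∧ HasDerivAt y₂ (-(p x * y₁ x)) x

section LinSol

variable {A s t : ℝ} {p : ℝ → ℂ} {y₁ y₂ z₁ z₂ : ℝ → ℂ}

theorem IsLinSol.sub (hy : IsLinSol A p s t y₁ y₂) (hz : IsLinSol A p s t z₁ z₂) :
    IsLinSol A p s t (fun x => y₁ x - z₁ x) (fun x => y₂ x - z₂ x) := fun x hx =>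
  ⟨((hy x hx).1.sub (hz x hx).1).congr_deriv (by ring),
    ((hy x hx).2.sub (hz x hx).2).congr_deriv (by ring)⟩

theorem IsLinSol.const_mul (hy : IsLinSol A p s t y₁ y₂) (c : ℂ) :
    IsLinSol A p s t (fun x => c * y₁ x) (fun x => c * y₂ x) := fun x hx =>
  ⟨((hy x hx).1.const_mul c).congr_deriv (by ring),
    ((hy x hx).2.const_mul c).congr_deriv (by ring)⟩

theorem IsLinSol.eq_zero (hy : IsLinSol A p s t y₁ y₂) (hp : ContinuousOn p (Icc s t))
    (h₁ : y₁ s = 0) (h₂ : y₂ s = 0) : ∀ x ∈ Icc s t, y₁ x = 0 ∧ y₂ x = 0 := by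
  obtain ⟨B, hB⟩ := isCompact_Icc.exists_bound_of_continuousOn hp
  have hd : ∀ x ∈ Icc s t, HasDerivAt (fun x => (y₁ x, y₂ x)) (A * y₂ x, -(p x * y₁ x)) x :=
    fun x hx => (hy x hx).1.prodMk (hy x hx).2
  have h := eq_zero_of_abs_deriv_le_mul_abs_self_of_eq_zero_right (K := max |A| B)
    (fun x hx => (hd x hx).continuousAt.continuousWithinAt)
    (fun x hx => (hd x (Ico_subset_Icc_self hx)).hasDerivWithinAt) (by simp [h₁, h₂])
    (fun x hx => by
      simp only [Prod.norm_mk, norm_neg, norm_mul, Complex.norm_real, Real.norm_eq_abs]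
      apply max_le
      · exact mul_le_mul (le_max_left _ _) (le_max_right _ _) (norm_nonneg _)
          ((abs_nonneg _).trans (le_max_left _ _))
      · exact mul_le_mul ((hB x (Ico_subset_Icc_self hx)).trans (le_max_right _ _))
          (le_max_left _ _) (norm_nonneg _) ((abs_nonneg _).trans (le_max_left _ _)))
  intro x hx
  simpa using h x hx

/-- A Prüfer angle comes from a solution of the linear system. -/
theorem IsAngle.exists_amplitude {p : ℝ → ℝ} {θ : ℝ → ℝ} (hθ : IsAngle A p s t θ)
    (hp : Continuous p) (hst : s ≤ t) :
    ∃ ρ : ℝ → ℝ, ρ s = 1 ∧ (∀ x, 0 < ρ x) ∧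
      IsLinSol A (fun x => (p x : ℂ)) s t (fun x => ((ρ x * Real.sin (θ x) : ℝ) : ℂ))
        (fun x => ((ρ x * Real.cos (θ x) : ℝ) : ℂ)) := by
  let g : ℝ → ℝ := fun x => (A - p x) * Real.sin (θ x) * Real.cos (θ x)
  have hc := hθ.continuousOn
  have hg : ContinuousOn g (Icc s t) := by
    simp only [g]
    exact ((continuousOn_const.sub hp.continuousOn).mul
      (Real.continuous_sin.comp_continuousOn hc)).mul (Real.continuous_cos.comp_continuousOn hc)
  let G : ℝ → ℝ := IccExtend hst ((Icc s t).domRestrict g)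
  have hG : Continuous G := hg.domRestrict.Icc_extend'
  have hGg : ∀ x ∈ Icc s t, G x = g x := fun x hx => by
    simp only [G]
    rw [IccExtend_of_mem hst _ hx]; rfl
  let ρ : ℝ → ℝ := fun x => Real.exp (∫ y in s..x, G y)
  have hρ : ∀ x ∈ Icc s t, HasDerivAt ρ (ρ x * g x) x := fun x hx => by
    rw [← hGg x hx]
    exact ((hG.integral_hasStrictDerivAt s x).hasDerivAt).exp
  refine ⟨ρ, by simp [ρ], fun x => Real.exp_pos _, fun x hx => ⟨?_, ?_⟩⟩
  · have h := ((hρ x hx).mul (hθ x hx).sin).ofReal_comp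
    refine h.congr_deriv ?_
    rw [← Complex.ofReal_mul]
    congr 1
    simp only [g]
    linear_combination A * ρ x * Real.cos (θ x) * Real.sin_sq_add_cos_sq (θ x)
  · have h := ((hρ x hx).mul (hθ x hx).cos).ofReal_comp
    refine h.congr_deriv ?_
    rw [← Complex.ofReal_mul, ← Complex.ofReal_neg]
    congr 1
    simp only [g]
    linear_combination (-p x) * ρ x * Real.sin (θ x) * Real.sin_sq_add_cos_sq (θ x)

/-- A solution of the linear system that starts in the direction of the Prüfer angle keeps
following it, up to a positive amplitude. -/
theorem IsLinSol.exists_eq_mul {p : ℝ → ℝ} {θ : ℝ → ℝ}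
    (hy : IsLinSol A (fun x => (p x : ℂ)) s t y₁ y₂) (hθ : IsAngle A p s t θ)
    (hp : Continuous p) (hst : s ≤ t) {c : ℂ} (h₁ : y₁ s = c * Real.sin (θ s))
    (h₂ : y₂ s = c * Real.cos (θ s)) :
    ∃ ρ : ℝ → ℝ, (∀ x, 0 < ρ x) ∧ ∀ x ∈ Icc s t,
      y₁ x = c * ρ x * Real.sin (θ x) ∧ y₂ x = c * ρ x * Real.cos (θ x) := by
  obtain ⟨ρ, h0, hpos, hρ⟩ := hθ.exists_amplitude hp hst
  have h := (hy.sub (hρ.const_mul c)).eq_zero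
    (Complex.continuous_ofReal.comp hp).continuousOn (by simp [h0, h₁]) (by simp [h0, h₂])
  refine ⟨ρ, hpos, fun x hx => ⟨?_, ?_⟩⟩
  · rw [sub_eq_zero.1 (h x hx).1]; push_cast; ring
  · rw [sub_eq_zero.1 (h x hx).2]; push_cast; ring

/-- The quantity is the imaginary part of `conj y₁ * y₂`. The term with `A` contributes `A |y₂|²`,
which is real and drops out. -/
theorem IsLinSol.hasDerivAt_wronskian (hy : IsLinSol A p s t y₁ y₂) {x : ℝ} (hx : x ∈ Icc s t) :
    HasDerivAt (fun x => (y₁ x).re * (y₂ x).im - (y₁ x).im * (y₂ x).re)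
      (-((p x).im * Complex.normSq (y₁ x))) x := by
  obtain ⟨h₁, h₂⟩ := hy x hx
  have r₁ := Complex.reCLM.hasFDerivAt.comp_hasDerivAt x h₁
  have i₁ := Complex.imCLM.hasFDerivAt.comp_hasDerivAt x h₁
  have r₂ := Complex.reCLM.hasFDerivAt.comp_hasDerivAt x h₂
  have i₂ := Complex.imCLM.hasFDerivAt.comp_hasDerivAt x h₂
  refine ((r₁.mul i₂).sub (i₁.mul r₂)).congr_deriv ?_
  simp [Complex.normSq_apply]
  ring

/-- A solution of the second order equation inside an interval is the restriction of a solution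
of the first order system on the closed interval. -/
theorem exists_isLinSol_of_hasDerivAt {φ : ℝ → ℂ} {Q : ℝ → ℝ} {μ : ℂ} (hst : s < t)
    (hQ : Continuous Q) (hφ : ContinuousOn φ (Icc s t))
    (hd : ∀ x ∈ Ioo s t, DifferentiableAt ℝ φ x)
    (he : ∀ x ∈ Ioo s t, HasDerivAt (deriv φ) ((Q x : ℂ) * φ x - μ * φ x) x) :
    ∃ y₁ y₂ : ℝ → ℂ, IsLinSol 1 (fun x => μ - Q x) s t y₁ y₂ ∧ EqOn φ y₁ (Icc s t) ∧
      EqOn (deriv φ) y₂ (Ioo s t) := by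
  let φe : ℝ → ℂ := IccExtend hst.le ((Icc s t).domRestrict φ)
  have hφe : Continuous φe := hφ.domRestrict.Icc_extend'
  have hφφ : ∀ x ∈ Icc s t, φe x = φ x := fun x hx => by
    simp only [φe]
    rw [IccExtend_of_mem hst.le _ hx]; rfl
  let c := (s + t) / 2
  have hc : c ∈ Ioo s t := ⟨by simp only [c]; linarith, by simp only [c]; linarith⟩
  -- Integrating from the midpoint gives functions differentiable on all of `ℝ`. They agree with
  -- `φ'` and `φ` on the open interval, and for `φ` the agreement reaches the endpoints by
  -- continuity.
  let F : ℝ → ℂ := fun x => deriv φ c + ∫ y in c..x, ((Q y : ℂ) * φe y - μ * φe y)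
  have hF : ∀ x, HasDerivAt F ((Q x : ℂ) * φe x - μ * φe x) x := fun x => by
    have : Continuous fun y => (Q y : ℂ) * φe y - μ * φe y := by fun_prop
    exact ((this.integral_hasStrictDerivAt c x).hasDerivAt).const_add _
  have hFc : Continuous F := continuous_iff_continuousAt.2 fun x => (hF x).continuousAt
  let P : ℝ → ℂ := fun x => φ c + ∫ y in c..x, F y
  have hP : ∀ x, HasDerivAt P (F x) x := fun x =>
    ((hFc.integral_hasStrictDerivAt c x).hasDerivAt).const_add _
  have e2 : EqOn (deriv φ) F (Ioo s t) := by
    refine isOpen_Ioo.eqOn_of_deriv_eq isPreconnected_Ioo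
      (fun x hx => (he x hx).differentiableAt.differentiableWithinAt)
      (fun x _ => (hF x).differentiableAt.differentiableWithinAt) (fun x hx => ?_) hc (by simp [F])
    rw [(he x hx).deriv, (hF x).deriv, hφφ x (Ioo_subset_Icc_self hx)]
  have e1 : EqOn φ P (Ioo s t) := by
    refine isOpen_Ioo.eqOn_of_deriv_eq isPreconnected_Ioo
      (fun x hx => (hd x hx).differentiableWithinAt)
      (fun x _ => (hP x).differentiableAt.differentiableWithinAt) (fun x hx => ?_) hc (by simp [P])
    rw [e2 hx, (hP x).deriv]
  have hPc : Continuous P := continuous_iff_continuousAt.2 fun x => (hP x).continuousAt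
  have e1' : EqOn φ P (Icc s t) :=
    e1.of_subset_closure hφ hPc.continuousOn Ioo_subset_Icc_self (closure_Ioo hst.ne).ge
  refine ⟨P, F, fun x hx => ⟨(hP x).congr_deriv (by simp), (hF x).congr_deriv ?_⟩, e1', e2⟩
  rw [hφφ x hx, e1' hx]; ring

end LinSol

/-! ### Equivalence with a chain of systems, and reality of the spectrum -/

/-- The loaded string problem as a chain of first order systems on the closed subintervals. -/
structure IsChain {N : ℕ} (a : Fin (N + 2) → ℝ) (M : Fin N → ℝ) (Q : Fin (N + 1) → ℝ → ℝ)
    (μ : ℂ) (y₁ y₂ : Fin (N + 1) → ℝ → ℂ) : Prop where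
  isLinSol : ∀ j, IsLinSol 1 (fun x => μ - Q j x) (a j.castSucc) (a j.succ) (y₁ j) (y₂ j)
  left_end : y₁ 0 (a 0) = 0
  right_end : y₁ (Fin.last N) (a (Fin.last (N + 1))) = 0
  continuity : ∀ j : Fin N, y₁ j.succ (a j.succ.castSucc) = y₁ j.castSucc (a j.succ.castSucc)
  jump : ∀ j : Fin N, y₂ j.succ (a j.succ.castSucc) = y₂ j.castSucc (a j.succ.castSucc) -
    (M j : ℂ) * μ * y₁ j.castSucc (a j.succ.castSucc)

section Chain

variable {N : ℕ} {a : Fin (N + 2) → ℝ} {M : Fin N → ℝ} {q Q : Fin (N + 1) → ℝ → ℝ} {μ : ℂ}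

theorem exists_mem_Icc_castSucc_succ {x : ℝ} (h₀ : a 0 ≤ x) (h₁ : x ≤ a (Fin.last (N + 1))) :
    ∃ j : Fin (N + 1), x ∈ Icc (a j.castSucc) (a j.succ) := by
  by_contra hcon
  push Not at hcon
  have h : ∀ k : Fin (N + 2), a k ≤ x ∧ (k ≠ 0 → a k < x) := by
    intro k
    induction k using Fin.induction with
    | zero => exact ⟨h₀, fun h => absurd rfl h⟩
    | succ j ih =>
      have := hcon j
      have h2 : ¬ x ≤ a j.succ := fun h => this ⟨ih.1, h⟩
      exact ⟨(not_le.1 h2).le, fun _ => not_le.1 h2⟩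
  exact absurd h₁ (not_le.2 ((h (Fin.last (N + 1))).2 (Fin.last_pos.ne')))

theorem IsSolution.exists_isChain {φ : ℝ → ℂ} (ha : StrictMono a)
    (hQ : ∀ j, Continuous (Q j)) (hqQ : ∀ j, EqOn (q j) (Q j) (Icc (a j.castSucc) (a j.succ)))
    (h : IsSolution a M q μ φ) :
    ∃ y₁ y₂, IsChain a M Q μ y₁ y₂ ∧ ∀ j, EqOn φ (y₁ j) (Icc (a j.castSucc) (a j.succ)) := by
  have hlt : ∀ j : Fin (N + 1), a j.castSucc < a j.succ := fun j => ha Fin.castSucc_lt_succ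
  have hsub : ∀ j : Fin (N + 1), Icc (a j.castSucc) (a j.succ) ⊆
      Icc (a 0) (a (Fin.last (N + 1))) := fun j =>
    Icc_subset_Icc (ha.monotone (Fin.zero_le _)) (ha.monotone (Fin.le_last _))
  have := fun j => exists_isLinSol_of_hasDerivAt (hlt j) (hQ j) (h.continuousOn.mono (hsub j))
    (h.differentiableAt j) (fun x hx => by
      rw [← hqQ j (Ioo_subset_Icc_self hx)]; exact h.equation j x hx)
  choose y₁ y₂ hl he₁ he₂ using this
  refine ⟨y₁, y₂, ⟨hl, ?_, ?_, ?_, ?_⟩, he₁⟩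
  · rw [← h.left_end]
    exact (he₁ 0 (left_mem_Icc.2 (hlt 0).le)).symm
  · rw [← h.right_end]
    exact (he₁ (Fin.last N) (right_mem_Icc.2 (hlt (Fin.last N)).le)).symm
  · intro j
    have e1 := he₁ j.succ (left_mem_Icc.2 (hlt j.succ).le)
    have e2 := he₁ j.castSucc (right_mem_Icc.2 (hlt j.castSucc).le)
    rw [Fin.succ_castSucc] at e2
    rw [← e1, ← e2]
  · intro j
    obtain ⟨dl, dr, hdl, hdr, hj⟩ := h.jump j
    have e2 := he₁ j.castSucc (right_mem_Icc.2 (hlt j.castSucc).le)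
    have l2 := hlt j.castSucc
    have c2 := ((hl j.castSucc _ (right_mem_Icc.2 l2.le)).2.continuousAt).tendsto
    have eq2 := he₂ j.castSucc
    rw [Fin.succ_castSucc] at e2 l2 c2 eq2
    have l1 := hlt j.succ
    have c1 := ((hl j.succ _ (left_mem_Icc.2 l1.le)).2.continuousAt).tendsto
    have eq1 := he₂ j.succ
    -- Each component `y₂` is continuous up to the nodes, so its end values are the one-sided limits
    -- of `φ'`.
    have hr : dr = y₂ j.succ (a j.succ.castSucc) := by
      refine tendsto_nhds_unique hdr ((c1.mono_left nhdsWithin_le_nhds).congr' ?_)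
      filter_upwards [Ioo_mem_nhdsGT l1] with y hy using (eq1 hy).symm
    have hl : dl = y₂ j.castSucc (a j.succ.castSucc) := by
      refine tendsto_nhds_unique hdl ((c2.mono_left nhdsWithin_le_nhds).congr' ?_)
      filter_upwards [Ioo_mem_nhdsLT l2] with y hy using (eq2 hy).symm
    rw [← hr, ← hl, hj, e2]

/-- Distinct subintervals meet only at a common node, where the continuity condition applies. This
makes gluing independent of the chosen subinterval. -/
theorem IsChain.eq_of_mem_of_mem {y₁ y₂ : Fin (N + 1) → ℝ → ℂ} (h : IsChain a M Q μ y₁ y₂)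
    (ha : StrictMono a) {x : ℝ} {i j : Fin (N + 1)} (hi : x ∈ Icc (a i.castSucc) (a i.succ))
    (hj : x ∈ Icc (a j.castSucc) (a j.succ)) : y₁ i x = y₁ j x := by
  wlog hij : i < j generalizing i j
  · rcases (not_lt.1 hij).eq_or_lt with h' | h'
    · rw [h']
    · exact (this hj hi h').symm
  have h1 : i.succ ≤ j.castSucc := by
    rw [Fin.le_iff_val_le_val]; simpa using hij
  have h2 : a i.succ = a j.castSucc := le_antisymm (ha.monotone h1) (hj.1.trans hi.2)
  have h3 : x = a j.castSucc := le_antisymm (hi.2.trans h2.le) hj.1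
  have h4 : i.succ = j.castSucc := ha.injective h2
  have h5 : (i : ℕ) + 1 = j := by simpa using congrArg Fin.val h4
  obtain ⟨k, rfl⟩ : ∃ k : Fin N, j = k.succ :=
    ⟨⟨i, by have := j.2; omega⟩, Fin.ext (by simp [h5])⟩
  obtain rfl : i = k.castSucc := Fin.ext (by simpa using h5)
  rw [h3]
  exact (h.continuity k).symm

theorem IsChain.exists_isSolution {y₁ y₂ : Fin (N + 1) → ℝ → ℂ} (ha : StrictMono a)
    (hqQ : ∀ j, EqOn (q j) (Q j) (Icc (a j.castSucc) (a j.succ)))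
    (h : IsChain a M Q μ y₁ y₂) :
    ∃ φ, IsSolution a M q μ φ ∧ ∀ j, EqOn φ (y₁ j) (Icc (a j.castSucc) (a j.succ)) := by
  classical
  have hlt : ∀ j : Fin (N + 1), a j.castSucc < a j.succ := fun j => ha Fin.castSucc_lt_succ
  let φ : ℝ → ℂ := fun x =>
    if hx : ∃ j : Fin (N + 1), x ∈ Icc (a j.castSucc) (a j.succ) then y₁ hx.choose x else 0
  have hφ : ∀ j, EqOn φ (y₁ j) (Icc (a j.castSucc) (a j.succ)) := by
    intro j x hx
    have hex : ∃ j : Fin (N + 1), x ∈ Icc (a j.castSucc) (a j.succ) := ⟨j, hx⟩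
    simp only [φ, dif_pos hex]
    exact h.eq_of_mem_of_mem ha hex.choose_spec hx
  have hev : ∀ j, ∀ x ∈ Ioo (a j.castSucc) (a j.succ), φ =ᶠ[𝓝 x] y₁ j := fun j x hx => by
    filter_upwards [Icc_mem_nhds hx.1 hx.2] with y hy using hφ j hy
  have hd : ∀ j, ∀ x ∈ Ioo (a j.castSucc) (a j.succ), HasDerivAt φ (y₂ j x) x := fun j x hx =>
    (((h.isLinSol j x (Ioo_subset_Icc_self hx)).1).congr_of_eventuallyEq
      (hev j x hx)).congr_deriv (by simp)
  have hdev : ∀ j, ∀ x ∈ Ioo (a j.castSucc) (a j.succ), deriv φ =ᶠ[𝓝 x] y₂ j := fun j x hx => by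
    filter_upwards [Ioo_mem_nhds hx.1 hx.2] with y hy using (hd j y hy).deriv
  refine ⟨φ, ⟨?_, ?_, ?_, ?_, ?_, ?_⟩, hφ⟩
  · have : Icc (a 0) (a (Fin.last (N + 1))) ⊆
        ⋃ j : Fin (N + 1), Icc (a j.castSucc) (a j.succ) := fun x hx =>
      mem_iUnion.2 (exists_mem_Icc_castSucc_succ hx.1 hx.2)
    refine ContinuousOn.mono ?_ this
    refine (locallyFinite_of_finite _).continuousOn_iUnion (fun _ => isClosed_Icc) fun j => ?_
    exact ContinuousOn.congr
      (fun x hx => (h.isLinSol j x hx).1.continuousAt.continuousWithinAt) (hφ j)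
  · exact fun j x hx => (hd j x hx).differentiableAt
  · intro j x hx
    have hx' := Ioo_subset_Icc_self hx
    refine (((h.isLinSol j x hx').2).congr_of_eventuallyEq (hdev j x hx)).congr_deriv ?_
    rw [hqQ j hx', hφ j hx']; ring
  · rw [← h.left_end]
    exact hφ 0 (left_mem_Icc.2 (hlt 0).le)
  · rw [← h.right_end]
    exact hφ (Fin.last N) (right_mem_Icc.2 (hlt (Fin.last N)).le)
  · intro j
    refine ⟨y₂ j.castSucc (a j.succ.castSucc), y₂ j.succ (a j.succ.castSucc), ?_, ?_, ?_⟩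
    · have l2 := hlt j.castSucc
      have c2 := ((h.isLinSol j.castSucc _ (right_mem_Icc.2 l2.le)).2.continuousAt).tendsto
      have hd2 := hd j.castSucc
      rw [Fin.succ_castSucc] at l2 c2 hd2
      refine (c2.mono_left nhdsWithin_le_nhds).congr' ?_
      filter_upwards [Ioo_mem_nhdsLT l2] with y hy using (hd2 y hy).deriv.symm
    · have l1 := hlt j.succ
      have c1 := ((h.isLinSol j.succ _ (left_mem_Icc.2 l1.le)).2.continuousAt).tendsto
      refine (c1.mono_left nhdsWithin_le_nhds).congr' ?_
      filter_upwards [Ioo_mem_nhdsGT l1] with y hy using (hd j.succ y hy).deriv.symm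
    · rw [h.jump j, hφ j.succ (left_mem_Icc.2 (hlt j.succ).le), h.continuity j]

/-- The spectral parameter of a nontrivial chain is real. -/
theorem IsChain.im_eq_zero {y₁ y₂ : Fin (N + 1) → ℝ → ℂ} (ha : StrictMono a) (hM : ∀ j, 0 < M j)
    (h : IsChain a M Q μ y₁ y₂) {j : Fin (N + 1)} {x : ℝ}
    (hx : x ∈ Icc (a j.castSucc) (a j.succ)) (hne : y₁ j x ≠ 0) : μ.im = 0 := by
  by_contra hμ
  have hlt : ∀ j : Fin (N + 1), a j.castSucc < a j.succ := fun j => ha Fin.castSucc_lt_succ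
  -- The factor `μ.im` gives the Wronskian a definite sign: it is nonincreasing on each subinterval
  -- and cannot increase at a mass since `M j > 0`. Being zero at both ends of the string, it
  -- vanishes throughout, and its derivative then kills `y₁`.
  let w : Fin (N + 1) → ℝ → ℝ := fun j x =>
    μ.im * ((y₁ j x).re * (y₂ j x).im - (y₁ j x).im * (y₂ j x).re)
  have hw : ∀ j, ∀ x ∈ Icc (a j.castSucc) (a j.succ),
      HasDerivAt (w j) (-(μ.im ^ 2 * Complex.normSq (y₁ j x))) x := fun j x hx => by
    refine (((h.isLinSol j).hasDerivAt_wronskian hx).const_mul μ.im).congr_deriv ?_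
    simp; ring
  have hanti : ∀ j, AntitoneOn (w j) (Icc (a j.castSucc) (a j.succ)) := fun j => by
    refine antitoneOn_of_hasDerivWithinAt_nonpos (convex_Icc _ _)
      (f' := fun x => -(μ.im ^ 2 * Complex.normSq (y₁ j x)))
      (fun x hx => (hw j x hx).continuousAt.continuousWithinAt)
      (fun x hx => (hw j x (interior_subset hx)).hasDerivWithinAt) (fun x _ => ?_)
    have := mul_nonneg (sq_nonneg μ.im) (Complex.normSq_nonneg (y₁ j x))
    linarith
  have hjump : ∀ j : Fin N, w j.succ (a j.succ.castSucc) ≤ w j.castSucc (a j.succ.castSucc) := by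
    intro j
    have e : w j.succ (a j.succ.castSucc) = w j.castSucc (a j.succ.castSucc) -
        μ.im ^ 2 * M j * Complex.normSq (y₁ j.castSucc (a j.succ.castSucc)) := by
      simp only [w]
      rw [h.continuity j, h.jump j, Complex.normSq_apply]
      simp
      ring
    rw [e]
    have := mul_nonneg (mul_nonneg (sq_nonneg μ.im) (hM j).le)
      (Complex.normSq_nonneg (y₁ j.castSucc (a j.succ.castSucc)))
    linarith
  have hle : ∀ j : Fin (N + 1), w j (a j.castSucc) ≤ 0 := by
    intro j
    induction j using Fin.induction with
    | zero => simp [w, h.left_end]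
    | succ j ih =>
      have := hanti j.castSucc (left_mem_Icc.2 (hlt j.castSucc).le)
        (right_mem_Icc.2 (hlt j.castSucc).le) (hlt j.castSucc).le
      rw [Fin.succ_castSucc] at this
      exact (hjump j).trans (this.trans ih)
  have hge : ∀ j : Fin (N + 1), 0 ≤ w j (a j.succ) := by
    intro j
    induction j using Fin.reverseInduction with
    | last => simp [w, h.right_end, Fin.succ_last]
    | cast j ih =>
      have := hanti j.succ (left_mem_Icc.2 (hlt j.succ).le)
        (right_mem_Icc.2 (hlt j.succ).le) (hlt j.succ).le
      rw [Fin.succ_castSucc]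
      exact ih.trans (this.trans (hjump j))
  have hzero : ∀ y ∈ Icc (a j.castSucc) (a j.succ), w j y = 0 := fun y hy => le_antisymm
    ((hanti j (left_mem_Icc.2 (hlt j).le) hy hy.1).trans (hle j))
    ((hge j).trans (hanti j hy (right_mem_Icc.2 (hlt j).le) hy.2))
  have hy0 : EqOn (y₁ j) (fun _ => 0) (Ioo (a j.castSucc) (a j.succ)) := by
    intro y hy
    have e : w j =ᶠ[𝓝 y] fun _ => 0 := by
      filter_upwards [Icc_mem_nhds hy.1 hy.2] with z hz using hzero z hz
    have h1 := (hw j y (Ioo_subset_Icc_self hy)).unique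
      ((hasDerivAt_const y (0 : ℝ)).congr_of_eventuallyEq e)
    have h2 : μ.im ^ 2 * Complex.normSq (y₁ j y) = 0 := by linarith
    rcases mul_eq_zero.1 h2 with h3 | h3
    · exact absurd (pow_eq_zero_iff two_ne_zero |>.1 h3) hμ
    · exact Complex.normSq_eq_zero.1 h3
  exact hne (hy0.of_subset_closure
    (fun y hy => (h.isLinSol j y hy).1.continuousAt.continuousWithinAt) continuousOn_const
    Ioo_subset_Icc_self (closure_Ioo (hlt j).ne).ge hx)

end Chain

/-! ### The total angle and its characterization of the eigenvalues -/

section TotalAngle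

variable {N : ℕ} (a : Fin (N + 2) → ℝ) (M : Fin N → ℝ) (Q : Fin (N + 1) → ℝ → ℝ)

/-- The Prüfer angle at the right end of the `j`-th subinterval, from its value at the left end. -/
noncomputable def segmentAngle (j : Fin (N + 1)) (μ α : ℝ) : ℝ :=
  angle 1 (fun x => μ - Q j x) (a j.castSucc) (a j.succ) α (a j.succ)

/-- The Prüfer angle behind a mass `m`, from its value in front of it: a mass acts like a
unit time of the system `y₁' = 0`, `y₂' = -m μ y₁`. -/
noncomputable def massAngle (m μ α : ℝ) : ℝ := angle 0 (fun _ => m * μ) 0 1 α 1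

/-- The Prüfer angle at the left end of the `j`-th subinterval, behind the mass. -/
noncomputable def entryAngle (μ : ℝ) (j : Fin (N + 1)) : ℝ :=
  Fin.induction (motive := fun _ => ℝ) 0
    (fun i α => massAngle (M i) μ (segmentAngle a Q i.castSucc μ α)) j

/-- The Prüfer angle at the right end of the string. -/
noncomputable def totalAngle (μ : ℝ) : ℝ :=
  segmentAngle a Q (Fin.last N) μ (entryAngle a M Q μ (Fin.last N))

@[simp] theorem entryAngle_zero (μ : ℝ) : entryAngle a M Q μ 0 = 0 := rfl

theorem entryAngle_succ (μ : ℝ) (j : Fin N) : entryAngle a M Q μ j.succ =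
    massAngle (M j) μ (segmentAngle a Q j.castSucc μ (entryAngle a M Q μ j.castSucc)) :=
  Fin.induction_succ (motive := fun _ => ℝ) _ _ _

variable {a M Q}

theorem exists_isAngle_massAngle (m μ α : ℝ) :
    ∃ θ, IsAngle 0 (fun _ => m * μ) 0 1 θ ∧ θ 0 = α ∧ θ 1 = massAngle m μ α :=
  ⟨_, isAngle_angle _ _ continuous_const zero_le_one,
    angle_left _ _ continuous_const zero_le_one, rfl⟩

theorem continuous_massAngle (m : ℝ) {α : ℝ → ℝ} (hα : Continuous α) :
    Continuous fun μ => massAngle m μ (α μ) := by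
  have := continuous_angle_right (A := 0) (Q := fun _ => 0) continuous_const m
    (zero_le_one (α := ℝ)) hα
  simpa only [sub_zero, massAngle] using this

theorem massAngle_mono {m μ₁ μ₂ α₁ α₂ : ℝ} (hm : 0 ≤ m) (hμ : μ₁ ≤ μ₂) (hα : α₁ ≤ α₂) :
    massAngle m μ₁ α₁ ≤ massAngle m μ₂ α₂ := by
  obtain ⟨θ₁, h₁, s₁, t₁⟩ := exists_isAngle_massAngle m μ₁ α₁
  obtain ⟨θ₂, h₂, s₂, t₂⟩ := exists_isAngle_massAngle m μ₂ α₂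
  rw [← t₁, ← t₂]
  exact h₁.le h₂ zero_le_one continuous_const
    (fun _ => mul_le_mul_of_nonneg_left hμ hm) (by rwa [s₁, s₂])

theorem isAngle_zero_const {p : ℝ → ℝ} {s t α : ℝ} (hα : Real.sin α = 0) :
    IsAngle 0 p s t fun _ => α := fun x _ =>
  (hasDerivAt_const x α).congr_deriv (by simp [hα])

/-- For `A = 0` the multiples of `π` are equilibria. With monotonicity, this prevents a mass from
moving the angle past one. -/
theorem massAngle_of_sin_eq_zero {m μ α : ℝ} (hα : Real.sin α = 0) : massAngle m μ α = α := by
  obtain ⟨θ, h, s, t⟩ := exists_isAngle_massAngle m μ α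
  have hc := isAngle_zero_const (p := fun _ => m * μ) (s := 0) (t := 1) hα
  rw [← t]
  exact le_antisymm (h.le hc zero_le_one continuous_const (fun _ => le_rfl) s.le)
    (hc.le h zero_le_one continuous_const (fun _ => le_rfl) s.ge)

theorem massAngle_le_self {m μ α : ℝ} (hm : m * μ ≤ 0) : massAngle m μ α ≤ α := by
  obtain ⟨θ, h, s, t⟩ := exists_isAngle_massAngle m μ α
  rw [← t]
  refine angle_le_of_defect_le (A := 0) (p := fun _ => m * μ) zero_le_one continuousOn_const h
    (fun x _ => hasDerivAt_const x α) (fun x _ => ?_) s.le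
  have := mul_nonpos_of_nonpos_of_nonneg hm (sq_nonneg (Real.sin α))
  simp only [sub_self, zero_mul, zero_add, zero_sub]
  linarith

theorem exists_isAngle_segmentAngle (ha : StrictMono a) (hQ : ∀ j, Continuous (Q j))
    (j : Fin (N + 1)) (μ α : ℝ) :
    ∃ θ, IsAngle 1 (fun x => μ - Q j x) (a j.castSucc) (a j.succ) θ ∧ θ (a j.castSucc) = α ∧
      θ (a j.succ) = segmentAngle a Q j μ α :=
  have hlt : a j.castSucc ≤ a j.succ := (ha Fin.castSucc_lt_succ).le
  have hc : Continuous fun x => μ - Q j x := continuous_const.sub (hQ j)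
  ⟨_, isAngle_angle _ _ hc hlt, angle_left _ _ hc hlt, rfl⟩

theorem continuous_segmentAngle (ha : StrictMono a) (hQ : ∀ j, Continuous (Q j))
    (j : Fin (N + 1)) {α : ℝ → ℝ} (hα : Continuous α) :
    Continuous fun μ => segmentAngle a Q j μ (α μ) := by
  have := continuous_angle_right (A := 1) (hQ j) 1 (ha (Fin.castSucc_lt_succ (i := j))).le hα
  simpa only [one_mul, segmentAngle] using this

theorem segmentAngle_lt (ha : StrictMono a) (hQ : ∀ j, Continuous (Q j)) {j : Fin (N + 1)}
    {μ₁ μ₂ α₁ α₂ : ℝ} (hμ : μ₁ < μ₂) (hα : α₁ ≤ α₂) :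
    segmentAngle a Q j μ₁ α₁ < segmentAngle a Q j μ₂ α₂ := by
  obtain ⟨θ₁, h₁, s₁, t₁⟩ := exists_isAngle_segmentAngle ha hQ j μ₁ α₁
  obtain ⟨θ₂, h₂, s₂, t₂⟩ := exists_isAngle_segmentAngle ha hQ j μ₂ α₂
  rw [← t₁, ← t₂]
  exact h₁.lt_of_lt h₂ (ha Fin.castSucc_lt_succ) (continuous_const.sub (hQ j))
    (fun _ => sub_lt_sub_right hμ _) (by rwa [s₁, s₂])

/-- At angle `0` the field equals `1`, so the zero function is a strict subsolution. Returning to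
`0` would force the angle to be identically `0`. -/
theorem segmentAngle_pos (ha : StrictMono a) (hQ : ∀ j, Continuous (Q j)) {j : Fin (N + 1)}
    {μ α : ℝ} (hα : 0 ≤ α) : 0 < segmentAngle a Q j μ α := by
  obtain ⟨θ, h, s, t⟩ := exists_isAngle_segmentAngle ha hQ j μ α
  rw [← t]
  have hlt : a j.castSucc < a j.succ := ha Fin.castSucc_lt_succ
  by_contra hcon
  have heq := angle_eqOn_of_defect_le (A := 1) (p := fun x => μ - Q j x) (D₁ := fun _ => 0)
    (θ₁ := fun _ => 0) hlt.le (continuous_const.sub (hQ j)).continuousOn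
    (fun x _ => hasDerivAt_const x 0) h (fun x _ => by simp) (by rwa [s]) (not_lt.1 hcon)
  have hm : (a j.castSucc + a j.succ) / 2 ∈ Ioo (a j.castSucc) (a j.succ) :=
    ⟨by linarith, by linarith⟩
  have e : θ =ᶠ[𝓝 ((a j.castSucc + a j.succ) / 2)] fun _ => 0 := by
    filter_upwards [Icc_mem_nhds hm.1 hm.2] with z hz using (heq hz).symm
  have h1 := (h _ (Ioo_subset_Icc_self hm)).unique
    ((hasDerivAt_const _ (0 : ℝ)).congr_of_eventuallyEq e)
  rw [← heq (Ioo_subset_Icc_self hm)] at h1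
  simp at h1

/-- At `π / 2` the field equals `μ - Q ≤ 0`, so the constant `π / 2` is a barrier. -/
theorem segmentAngle_le_pi_div_two (ha : StrictMono a) (hQ : ∀ j, Continuous (Q j))
    {j : Fin (N + 1)} {μ α : ℝ} (hμ : ∀ x ∈ Icc (a j.castSucc) (a j.succ), μ ≤ Q j x)
    (hα : α ≤ Real.pi / 2) : segmentAngle a Q j μ α ≤ Real.pi / 2 := by
  obtain ⟨θ, h, s, t⟩ := exists_isAngle_segmentAngle ha hQ j μ α
  rw [← t]
  refine angle_le_of_defect_le (A := 1) (p := fun x => μ - Q j x)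
    (ha (Fin.castSucc_lt_succ (i := j))).le (continuous_const.sub (hQ j)).continuousOn h
    (fun x _ => hasDerivAt_const x (Real.pi / 2)) (fun x hx => ?_) (by rwa [s])
  have := hμ x hx
  simp
  linarith

theorem continuous_entryAngle (ha : StrictMono a) (hQ : ∀ j, Continuous (Q j))
    (j : Fin (N + 1)) : Continuous fun μ => entryAngle a M Q μ j := by
  induction j using Fin.induction with
  | zero => exact continuous_const
  | succ j ih =>
    simp only [entryAngle_succ]
    exact continuous_massAngle _ (continuous_segmentAngle ha hQ _ ih)

theorem continuous_totalAngle (ha : StrictMono a) (hQ : ∀ j, Continuous (Q j)) :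
    Continuous (totalAngle a M Q) :=
  continuous_segmentAngle ha hQ _ (continuous_entryAngle ha hQ _)

theorem monotone_entryAngle (ha : StrictMono a) (hM : ∀ j, 0 < M j) (hQ : ∀ j, Continuous (Q j))
    (j : Fin (N + 1)) : Monotone fun μ => entryAngle a M Q μ j := by
  induction j using Fin.induction with
  | zero => exact monotone_const
  | succ j ih =>
    intro μ₁ μ₂ h
    rcases h.eq_or_lt with rfl | h'
    · exact le_rfl
    simp only [entryAngle_succ]
    exact massAngle_mono (hM j).le h (segmentAngle_lt ha hQ h' (ih h)).le

theorem strictMono_totalAngle (ha : StrictMono a) (hM : ∀ j, 0 < M j)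
    (hQ : ∀ j, Continuous (Q j)) : StrictMono (totalAngle a M Q) := fun _ _ h =>
  segmentAngle_lt ha hQ h (monotone_entryAngle ha hM hQ _ h.le)

theorem entryAngle_nonneg (ha : StrictMono a) (hM : ∀ j, 0 < M j) (hQ : ∀ j, Continuous (Q j))
    (μ : ℝ) (j : Fin (N + 1)) : 0 ≤ entryAngle a M Q μ j := by
  induction j using Fin.induction with
  | zero => exact le_rfl
  | succ j ih =>
    rw [entryAngle_succ]
    calc (0 : ℝ) = massAngle (M j) μ 0 := (massAngle_of_sin_eq_zero Real.sin_zero).symm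
      _ ≤ _ := massAngle_mono (hM j).le le_rfl (segmentAngle_pos ha hQ ih).le

theorem totalAngle_pos (ha : StrictMono a) (hM : ∀ j, 0 < M j) (hQ : ∀ j, Continuous (Q j))
    (μ : ℝ) : 0 < totalAngle a M Q μ :=
  segmentAngle_pos ha hQ (entryAngle_nonneg ha hM hQ μ _)

theorem exists_abs_le (a : Fin (N + 2) → ℝ) (hQ : ∀ j, Continuous (Q j)) :
    ∃ B, 0 ≤ B ∧ ∀ j, ∀ x ∈ Icc (a j.castSucc) (a j.succ), |Q j x| ≤ B := by
  have := fun j => (isCompact_Icc (a := a (Fin.castSucc j))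
    (b := a j.succ)).exists_bound_of_continuousOn (hQ j).continuousOn
  choose B hB using this
  refine ⟨∑ j, |B j|, Finset.sum_nonneg fun _ _ => abs_nonneg _, fun j x hx => ?_⟩
  exact (hB j x hx).trans ((le_abs_self _).trans
    (Finset.single_le_sum (f := fun j => |B j|) (fun _ _ => abs_nonneg _) (Finset.mem_univ j)))

/-- For `μ = -B`, below all potentials and nonpositive, segments respect the barrier `π / 2` and
masses only lower the angle. -/
theorem exists_totalAngle_lt_pi (ha : StrictMono a) (hM : ∀ j, 0 < M j)
    (hQ : ∀ j, Continuous (Q j)) : ∃ μ, totalAngle a M Q μ < Real.pi := by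
  obtain ⟨B, hB0, hB⟩ := exists_abs_le a hQ
  have hμ : ∀ j, ∀ x ∈ Icc (a j.castSucc) (a j.succ), -B ≤ Q j x := fun j x hx =>
    (abs_le.1 (hB j x hx)).1
  have h : ∀ j, entryAngle a M Q (-B) j ≤ Real.pi / 2 := by
    intro j
    induction j using Fin.induction with
    | zero => exact (by positivity : (0 : ℝ) ≤ Real.pi / 2)
    | succ j ih =>
      rw [entryAngle_succ]
      exact (massAngle_le_self (mul_nonpos_of_nonneg_of_nonpos (hM j).le (by linarith))).trans
        (segmentAngle_le_pi_div_two ha hQ (hμ _) ih)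
  exact ⟨-B, (segmentAngle_le_pi_div_two ha hQ (hμ _) (h _)).trans_lt (half_lt_self Real.pi_pos)⟩

/-- Passing a mass, in terms of amplitude and Prüfer angle. -/
theorem exists_massAngle_amplitude (m μ α : ℝ) : ∃ r : ℝ, 0 < r ∧
    r * Real.sin (massAngle m μ α) = Real.sin α ∧
    r * Real.cos (massAngle m μ α) = Real.cos α - m * μ * Real.sin α := by
  obtain ⟨θ, h, s, t⟩ := exists_isAngle_massAngle m μ α
  -- The mass system is solved explicitly: constant first component, linear second one, reproducing
  -- the jump condition at time `1`.
  have hl : IsLinSol 0 (fun _ => ((m * μ : ℝ) : ℂ)) 0 1 (fun _ => (Real.sin α : ℂ))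
      (fun x : ℝ => (Real.cos α : ℂ) - x * (m * μ : ℝ) * Real.sin α) := by
    intro x _
    refine ⟨(hasDerivAt_const x _).congr_deriv (by simp), ?_⟩
    have h1 : HasDerivAt (fun x : ℝ => (x : ℂ)) 1 x := (hasDerivAt_id x).ofReal_comp
    refine (((h1.mul_const ((m * μ : ℝ) : ℂ)).mul_const (Real.sin α : ℂ)).const_sub
      (Real.cos α : ℂ)).congr_deriv (by ring)
  obtain ⟨ρ, hρ, hh⟩ := hl.exists_eq_mul (c := 1) h continuous_const zero_le_one (by simp [s])
    (by simp [s])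
  obtain ⟨e1, e2⟩ := hh 1 (right_mem_Icc.2 zero_le_one)
  rw [t] at e1 e2
  refine ⟨ρ 1, hρ 1, ?_, ?_⟩
  · apply Complex.ofReal_injective
    push_cast
    push_cast at e1
    rw [e1]; ring
  · apply Complex.ofReal_injective
    push_cast
    push_cast at e2
    linear_combination -e2

/-- The pair `(y₁, y₂)` stays a positive multiple of `c (sin θ, cos θ)` with one complex constant
`c`, the initial slope. Nontriviality gives `c ≠ 0`, so the right end condition falls on the sine.
-/
theorem IsChain.sin_totalAngle_eq_zero {y₁ y₂ : Fin (N + 1) → ℝ → ℂ} {μ : ℝ}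
    (ha : StrictMono a) (hQ : ∀ j, Continuous (Q j)) (h : IsChain a M Q μ y₁ y₂)
    {i : Fin (N + 1)} {x : ℝ} (hx : x ∈ Icc (a i.castSucc) (a i.succ)) (hne : y₁ i x ≠ 0) :
    Real.sin (totalAngle a M Q μ) = 0 := by
  have hlt : ∀ j : Fin (N + 1), a j.castSucc < a j.succ := fun j => ha Fin.castSucc_lt_succ
  let c := y₂ 0 (a 0)
  have hl : ∀ j, IsLinSol 1 (fun x => ((μ - Q j x : ℝ) : ℂ)) (a j.castSucc) (a j.succ)
      (y₁ j) (y₂ j) := fun j => by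
    simpa only [Complex.ofReal_sub] using h.isLinSol j
  have hc : ∀ j, Continuous fun x => μ - Q j x := fun j => continuous_const.sub (hQ j)
  have step : ∀ j (r : ℝ), y₁ j (a j.castSucc) = c * r * Real.sin (entryAngle a M Q μ j) →
      y₂ j (a j.castSucc) = c * r * Real.cos (entryAngle a M Q μ j) →
      ∃ (ρ θ : ℝ → ℝ), (∀ x, 0 < ρ x) ∧
        θ (a j.succ) = segmentAngle a Q j μ (entryAngle a M Q μ j) ∧
        ∀ x ∈ Icc (a j.castSucc) (a j.succ), y₁ j x = c * r * ρ x * Real.sin (θ x) ∧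
          y₂ j x = c * r * ρ x * Real.cos (θ x) := by
    intro j r h1 h2
    obtain ⟨θ, hθ, s, t⟩ := exists_isAngle_segmentAngle ha hQ j μ (entryAngle a M Q μ j)
    obtain ⟨ρ, hρ, hh⟩ := (hl j).exists_eq_mul hθ (hc j) (hlt j).le (c := c * r)
      (by rw [h1, s]) (by rw [h2, s])
    exact ⟨ρ, θ, hρ, t, hh⟩
  have hentry : ∀ j, ∃ r : ℝ, 0 < r ∧ y₁ j (a j.castSucc) =
      c * r * Real.sin (entryAngle a M Q μ j) ∧
      y₂ j (a j.castSucc) = c * r * Real.cos (entryAngle a M Q μ j) := by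
    intro j
    induction j using Fin.induction with
    | zero => exact ⟨1, one_pos, by simp [h.left_end], by simp [c]⟩
    | succ j ih =>
      obtain ⟨r, hr, h1, h2⟩ := ih
      obtain ⟨ρ, θ, hρ, t, hh⟩ := step _ r h1 h2
      obtain ⟨e1, e2⟩ := hh _ (right_mem_Icc.2 (hlt _).le)
      obtain ⟨k, hk, k1, k2⟩ := exists_massAngle_amplitude (M j) μ
        (segmentAngle a Q j.castSucc μ (entryAngle a M Q μ j.castSucc))
      rw [t] at e1 e2
      rw [Fin.succ_castSucc] at e1 e2
      refine ⟨r * ρ (a j.succ.castSucc) * k, by have := hρ (a j.succ.castSucc); positivity, ?_, ?_⟩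
      · rw [h.continuity, e1, entryAngle_succ, ← k1]
        push_cast; ring
      · rw [h.jump, e1, e2, entryAngle_succ]
        have k2' := congrArg (fun z : ℝ => (z : ℂ)) k2
        push_cast at k2' ⊢
        linear_combination -(c * r * ρ (a j.succ.castSucc)) * k2'
  have hc0 : c ≠ 0 := by
    intro hc0
    obtain ⟨r, _, h1, h2⟩ := hentry i
    obtain ⟨ρ, θ, _, _, hh⟩ := step _ r h1 h2
    apply hne
    rw [(hh x hx).1, hc0]; simp
  obtain ⟨r, hr, h1, h2⟩ := hentry (Fin.last N)
  obtain ⟨ρ, θ, hρ, t, hh⟩ := step _ r h1 h2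
  have e1 := (hh _ (right_mem_Icc.2 (hlt _).le)).1
  rw [Fin.succ_last, h.right_end, ← Fin.succ_last, t] at e1
  have := (hρ (a (Fin.last N).succ)).ne'
  rcases mul_eq_zero.1 e1.symm with h3 | h3
  · exact absurd h3 (by simp only [mul_eq_zero, Complex.ofReal_eq_zero, hc0, hr.ne', this,
      or_self, not_false_eq_true])
  · exact_mod_cast h3

theorem exists_isChain_of_sin_totalAngle_eq_zero {μ : ℝ} (ha : StrictMono a)
    (hQ : ∀ j, Continuous (Q j)) (hsin : Real.sin (totalAngle a M Q μ) = 0) :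
    ∃ y₁ y₂, IsChain a M Q μ y₁ y₂ ∧ ∃ x ∈ Icc (a (0 : Fin (N + 1)).castSucc)
      (a (0 : Fin (N + 1)).succ), y₁ 0 x ≠ 0 := by
  have hlt : ∀ j : Fin (N + 1), a j.castSucc < a j.succ := fun j => ha Fin.castSucc_lt_succ
  have hc : ∀ j, Continuous fun x => μ - Q j x := fun j => continuous_const.sub (hQ j)
  have := fun j => exists_isAngle_segmentAngle ha hQ j μ (entryAngle a M Q μ j)
  choose θ hθ hs ht using this
  have := fun j => (hθ j).exists_amplitude (hc j) (hlt j).le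
  choose ρ h0 hρ hl using this
  have := fun j : Fin N => exists_massAngle_amplitude (M j) μ
    (segmentAngle a Q j.castSucc μ (entryAngle a M Q μ j.castSucc))
  choose k hk k1 k2 using this
  -- The amplitude accumulated over the preceding segments and masses, so that the pieces match at
  -- the nodes.
  let r : Fin (N + 1) → ℝ := Fin.induction (motive := fun _ => ℝ) 1
    (fun i z => z * ρ i.castSucc (a i.succ.castSucc) * k i)
  have hr0 : r 0 = 1 := rfl
  have hrs : ∀ i : Fin N, r i.succ = r i.castSucc * ρ i.castSucc (a i.succ.castSucc) * k i :=
    fun i => Fin.induction_succ (motive := fun _ => ℝ) _ _ _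
  refine ⟨fun j x => r j * ((ρ j x * Real.sin (θ j x) : ℝ) : ℂ),
    fun j x => r j * ((ρ j x * Real.cos (θ j x) : ℝ) : ℂ), ⟨?_, ?_, ?_, ?_, ?_⟩, ?_⟩
  · intro j
    simpa only [Complex.ofReal_sub] using (hl j).const_mul (r j : ℂ)
  · have := hs 0
    simp only [Fin.castSucc_zero, entryAngle_zero] at this
    simp [this]
  · have := ht (Fin.last N)
    rw [Fin.succ_last] at this
    simp only [this]
    change ((r _ : ℂ)) * ((_ * Real.sin (totalAngle a M Q μ) : ℝ) : ℂ) = 0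
    rw [hsin]; simp
  · intro j
    have t := ht j.castSucc
    rw [Fin.succ_castSucc] at t
    simp only [hs j.succ, h0 j.succ, t, hrs, entryAngle_succ, ← k1]
    push_cast; ring
  · intro j
    have t := ht j.castSucc
    rw [Fin.succ_castSucc] at t
    simp only [hs j.succ, h0 j.succ, t, hrs, entryAngle_succ]
    have k2' := congrArg (fun z : ℝ => (z : ℂ)) (k2 j)
    push_cast at k2' ⊢
    linear_combination (r j.castSucc : ℂ) * ρ j.castSucc (a j.succ.castSucc) * k2'
  · obtain ⟨x, hx, hne⟩ := (hθ 0).exists_sin_ne_zero (hlt 0)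
    refine ⟨x, Ioo_subset_Icc_self hx, ?_⟩
    exact mul_ne_zero (Complex.ofReal_ne_zero.2 (hr0.trans_ne one_ne_zero))
      (Complex.ofReal_ne_zero.2 (mul_ne_zero (hρ 0 x).ne' hne))

/-- The eigenvalues are the real zeros of the sine of the total Prüfer angle. -/
theorem mem_eigenvalues_iff {q : Fin (N + 1) → ℝ → ℝ} {z : ℂ} (ha : StrictMono a)
    (hM : ∀ j, 0 < M j) (hQ : ∀ j, Continuous (Q j))
    (hqQ : ∀ j, EqOn (q j) (Q j) (Icc (a j.castSucc) (a j.succ))) :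
    z ∈ eigenvalues a M q ↔ ∃ μ : ℝ, Real.sin (totalAngle a M Q μ) = 0 ∧ (μ : ℂ) = z := by
  constructor
  · rintro ⟨φ, hφ, x, hx, hne⟩
    obtain ⟨y₁, y₂, hy, he⟩ := hφ.exists_isChain ha hQ hqQ
    obtain ⟨j, hj⟩ := exists_mem_Icc_castSucc_succ hx.1 hx.2
    rw [he j hj] at hne
    have him := hy.im_eq_zero ha hM hj hne
    have hz : ((z.re : ℝ) : ℂ) = z := Complex.ext (by simp) (by simp [him])
    rw [← hz] at hy
    exact ⟨z.re, hy.sin_totalAngle_eq_zero ha hQ hj hne, hz⟩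
  · rintro ⟨μ, hμ, rfl⟩
    obtain ⟨y₁, y₂, hy, x, hx, hne⟩ := exists_isChain_of_sin_totalAngle_eq_zero ha hQ hμ
    obtain ⟨φ, hφ, he⟩ := hy.exists_isSolution ha hqQ
    refine ⟨φ, hφ, x, ⟨?_, ?_⟩, by rwa [he 0 hx]⟩
    · exact (ha.monotone (Fin.zero_le _)).trans hx.1
    · exact hx.2.trans (ha.monotone (Fin.le_last _))

end TotalAngle

/-! ### The scaled angle -/

/-- The Prüfer angle `ψ` with `tan ψ = k tan θ`. -/
noncomputable def scaledAngle (k θ : ℝ) : ℝ :=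
  θ + Real.arctan ((k - 1) * (Real.sin θ * Real.cos θ) / (Real.cos θ ^ 2 + k * Real.sin θ ^ 2))

section ScaledAngle

variable {k : ℝ}

theorem cos_sq_add_mul_sin_sq_pos (hk : 0 < k) (θ : ℝ) :
    0 < Real.cos θ ^ 2 + k * Real.sin θ ^ 2 := by
  by_cases h : Real.sin θ = 0
  · have := Real.sin_sq_add_cos_sq θ
    rw [h] at this ⊢
    nlinarith
  · positivity

theorem scaledAngle_sq_add_sq (k θ : ℝ) :
    (Real.cos θ ^ 2 + k * Real.sin θ ^ 2) ^ 2 + ((k - 1) * (Real.sin θ * Real.cos θ)) ^ 2 =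
      Real.cos θ ^ 2 + k ^ 2 * Real.sin θ ^ 2 := by
  have h : Real.cos θ ^ 2 = 1 - Real.sin θ ^ 2 := by linarith [Real.sin_sq_add_cos_sq θ]
  linear_combination (Real.cos θ ^ 2 + k ^ 2 * Real.sin θ ^ 2) * h

theorem one_add_sq_scaledAngle (hk : 0 < k) (θ : ℝ) :
    1 + ((k - 1) * (Real.sin θ * Real.cos θ) / (Real.cos θ ^ 2 + k * Real.sin θ ^ 2)) ^ 2 =
      (Real.cos θ ^ 2 + k ^ 2 * Real.sin θ ^ 2) / (Real.cos θ ^ 2 + k * Real.sin θ ^ 2) ^ 2 := by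
  have hD := pow_pos (cos_sq_add_mul_sin_sq_pos hk θ) 2
  rw [div_pow, eq_div_iff hD.ne', add_mul, div_mul_cancel₀ _ hD.ne', one_mul,
    scaledAngle_sq_add_sq]

/-- This is the derivative of `arctan (k tan θ)`. Writing `ψ = θ + arctan (tan (ψ - θ))` gives a
branch smooth for all `θ`, as the denominator never vanishes. -/
theorem hasDerivAt_scaledAngle (hk : 0 < k) (θ : ℝ) :
    HasDerivAt (scaledAngle k) (k / (Real.cos θ ^ 2 + k ^ 2 * Real.sin θ ^ 2)) θ := by
  have hD := cos_sq_add_mul_sin_sq_pos hk θ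
  have hE := cos_sq_add_mul_sin_sq_pos (pow_pos hk 2) θ
  have hs := Real.hasDerivAt_sin θ
  have hc := Real.hasDerivAt_cos θ
  have h := (hasDerivAt_id θ).add ((((hs.mul hc).const_mul (k - 1)).div
    ((hc.pow 2).add ((hs.pow 2).const_mul k)) hD.ne').arctan)
  refine h.congr_deriv ?_
  simp only [Pi.add_apply, Pi.mul_apply, Pi.pow_apply, Pi.div_apply]
  rw [one_add_sq_scaledAngle hk]
  have hn : (k - 1) * (Real.cos θ * Real.cos θ + Real.sin θ * -Real.sin θ) *
      (Real.cos θ ^ 2 + k * Real.sin θ ^ 2) - (k - 1) * (Real.sin θ * Real.cos θ) *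
      ((2 : ℕ) * Real.cos θ ^ (2 - 1) * -Real.sin θ +
        k * ((2 : ℕ) * Real.sin θ ^ (2 - 1) * Real.cos θ)) =
      (k - 1) * (Real.cos θ ^ 2 - k * Real.sin θ ^ 2) := by
    push_cast
    linear_combination (k - 1) * (Real.cos θ ^ 2 - k * Real.sin θ ^ 2) *
      Real.sin_sq_add_cos_sq θ
  rw [hn, one_div_div, div_mul_div_cancel₀' (pow_pos hD 2).ne', eq_div_iff hE.ne', add_mul,
    div_mul_cancel₀ _ hE.ne']
  linear_combination k * Real.sin_sq_add_cos_sq θ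

theorem strictMono_scaledAngle (hk : 0 < k) : StrictMono (scaledAngle k) :=
  strictMono_of_hasDerivAt_pos (hasDerivAt_scaledAngle hk) fun θ =>
    div_pos hk (cos_sq_add_mul_sin_sq_pos (pow_pos hk 2) θ)

theorem scaledAngle_of_sin_eq_zero {θ : ℝ} (h : Real.sin θ = 0) : scaledAngle k θ = θ := by
  simp [scaledAngle, h]

theorem sin_scaledAngle_sq (hk : 0 < k) (θ : ℝ) : Real.sin (scaledAngle k θ) ^ 2 =
    k ^ 2 * Real.sin θ ^ 2 / (Real.cos θ ^ 2 + k ^ 2 * Real.sin θ ^ 2) := by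
  have hD := cos_sq_add_mul_sin_sq_pos hk θ
  have hE := cos_sq_add_mul_sin_sq_pos (pow_pos hk 2) θ
  rw [scaledAngle, Real.sin_add]
  set z := (k - 1) * (Real.sin θ * Real.cos θ) / (Real.cos θ ^ 2 + k * Real.sin θ ^ 2) with hz
  have h1 : 1 + z ^ 2 = (Real.cos θ ^ 2 + k ^ 2 * Real.sin θ ^ 2) /
      (Real.cos θ ^ 2 + k * Real.sin θ ^ 2) ^ 2 := one_add_sq_scaledAngle hk θ
  have h2 : Real.sin θ + Real.cos θ * z =
      k * Real.sin θ / (Real.cos θ ^ 2 + k * Real.sin θ ^ 2) := by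
    rw [hz, eq_div_iff hD.ne', add_mul, mul_assoc, div_mul_cancel₀ _ hD.ne']
    linear_combination k * Real.sin θ * Real.sin_sq_add_cos_sq θ
  have h3 : (Real.sin θ * Real.cos (Real.arctan z) + Real.cos θ * Real.sin (Real.arctan z)) =
      (Real.sin θ + Real.cos θ * z) / √(1 + z ^ 2) := by
    rw [Real.cos_arctan, Real.sin_arctan]; ring
  rw [h3, div_pow, Real.sq_sqrt (by positivity), h1, h2]
  field_simp

/-- On a subinterval the scaled angle grows at rate nearly `k`. -/
theorem IsAngle.abs_scaledAngle_sub_le {Q θ : ℝ → ℝ} {s t B : ℝ} (hk : 0 < k)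
    (h : IsAngle 1 (fun x => k ^ 2 - Q x) s t θ) (hst : s ≤ t) (hB : ∀ x ∈ Icc s t, |Q x| ≤ B) :
    |scaledAngle k (θ t) - scaledAngle k (θ s) - k * (t - s)| ≤ B / k * (t - s) := by
  -- Without potential the scaled angle grows at rate exactly `k`. The remainder is `Q` times a
  -- factor of size at most `1 / k`.
  have hd : ∀ x ∈ Icc s t, HasDerivWithinAt (fun x => scaledAngle k (θ x) - k * x)
      (-(Q x * (k * Real.sin (θ x) ^ 2) / (Real.cos (θ x) ^ 2 + k ^ 2 * Real.sin (θ x) ^ 2)))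
      (Icc s t) x := fun x hx => by
    have hE := cos_sq_add_mul_sin_sq_pos (pow_pos hk 2) (θ x)
    refine ((((hasDerivAt_scaledAngle hk (θ x)).comp x (h x hx)).sub
      ((hasDerivAt_id x).const_mul k)).congr_deriv ?_).hasDerivWithinAt
    field_simp
    ring
  have hb : ∀ x ∈ Icc s t, ‖-(Q x * (k * Real.sin (θ x) ^ 2) /
      (Real.cos (θ x) ^ 2 + k ^ 2 * Real.sin (θ x) ^ 2))‖ ≤ B / k := fun x hx => by
    have hE := cos_sq_add_mul_sin_sq_pos (pow_pos hk 2) (θ x)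
    have hB0 : 0 ≤ B := (abs_nonneg _).trans (hB x hx)
    rw [norm_neg, Real.norm_eq_abs, abs_div, abs_mul, abs_of_pos hE,
      abs_of_nonneg (by positivity : 0 ≤ k * Real.sin (θ x) ^ 2), div_le_div_iff₀ hE hk]
    calc |Q x| * (k * Real.sin (θ x) ^ 2) * k ≤ B * (k * Real.sin (θ x) ^ 2) * k := by
          gcongr; exact hB x hx
      _ = B * (k ^ 2 * Real.sin (θ x) ^ 2) := by ring
      _ ≤ B * (Real.cos (θ x) ^ 2 + k ^ 2 * Real.sin (θ x) ^ 2) := by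
          gcongr; linarith [sq_nonneg (Real.cos (θ x))]
  have := (convex_Icc s t).norm_image_sub_le_of_norm_hasDerivWithin_le hd hb
    (left_mem_Icc.2 hst) (right_mem_Icc.2 hst)
  rw [Real.norm_eq_abs, Real.norm_eq_abs, abs_of_nonneg (sub_nonneg.2 hst)] at this
  refine le_trans (le_of_eq ?_) this
  congr 1; ring

/-- Scaling keeps the form of the mass equation and replaces its strength `m k²` by `k m`, which is
still large. -/
theorem IsAngle.scaledAngle {θ : ℝ → ℝ} {s t m : ℝ} (hk : 0 < k)
    (h : IsAngle 0 (fun _ => m * k ^ 2) s t θ) :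
    IsAngle 0 (fun _ => k * m) s t fun x => scaledAngle k (θ x) := fun x hx => by
  refine ((hasDerivAt_scaledAngle hk (θ x)).comp x (h x hx)).congr_deriv ?_
  rw [sin_scaledAngle_sq hk]
  ring

/-- A large mass turns the scaled angle almost up to the next multiple of `π`. -/
theorem IsAngle.le_of_large {ψ : ℝ → ℝ} {P : ℝ} (hP : 0 < P) (h : IsAngle 0 (fun _ => P) 0 1 ψ)
    (n : ℤ) (h₀ : n * Real.pi + 2 / P ≤ ψ 0) : (n + 1) * Real.pi - 2 / P ≤ ψ 1 := by
  by_contra hcon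
  rw [not_le] at hcon
  have hmono : MonotoneOn ψ (Icc 0 1) :=
    monotoneOn_of_hasDerivWithinAt_nonneg (convex_Icc 0 1) h.continuousOn
      (fun x hx => (h x (interior_subset hx)).hasDerivWithinAt) (fun x _ => by positivity)
  have h0 : (0 : ℝ) ∈ Icc (0 : ℝ) 1 := left_mem_Icc.2 zero_le_one
  have h1 : (1 : ℝ) ∈ Icc (0 : ℝ) 1 := right_mem_Icc.2 zero_le_one
  have hP2 : 0 < 2 / P := by positivity
  have hx0 : ∀ x ∈ Icc (0 : ℝ) 1, 2 / P ≤ ψ x - n * Real.pi := fun x hx => by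
    linarith [hmono h0 hx hx.1]
  have hx1 : ∀ x ∈ Icc (0 : ℝ) 1, 2 / P < Real.pi - (ψ x - n * Real.pi) := fun x hx => by
    linarith [hmono hx h1 hx.2]
  have hsin : ∀ x ∈ Icc (0 : ℝ) 1, 0 < Real.sin (ψ x - n * Real.pi) := fun x hx =>
    Real.sin_pos_of_pos_of_lt_pi (by linarith [hx0 x hx]) (by linarith [hx1 x hx])
  have hcot : ∀ y : ℝ, 0 < y → y < Real.pi → Real.cos y / Real.sin y < 1 / y := by
    intro y hy0 hy1
    have hs := Real.sin_pos_of_pos_of_lt_pi hy0 hy1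
    rw [div_lt_div_iff₀ hs hy0, one_mul]
    rcases lt_or_ge y (Real.pi / 2) with hlt | hge
    · have := Real.lt_tan hy0 hlt
      rw [Real.tan_eq_sin_div_cos, lt_div_iff₀
        (Real.cos_pos_of_mem_Ioo ⟨by linarith, hlt⟩)] at this
      linarith
    · have := Real.cos_nonpos_of_pi_div_two_le_of_le hge (by linarith)
      nlinarith
  -- The equation gives `(cot ψ)' = -P`, so the cotangent falls by `P` in unit time. If both ends
  -- stay at least `2 / P` away from multiples of `π`, then `cot y < 1 / y` allows a fall of less
  -- than `P`.
  have hd : ∀ x ∈ Icc (0 : ℝ) 1, HasDerivWithinAt (fun x => Real.cos (ψ x - n * Real.pi) /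
      Real.sin (ψ x - n * Real.pi) + P * x) 0 (Icc 0 1) x := fun x hx => by
    have hs := (hsin x hx).ne'
    have hψ := (h x hx).sub_const (n * Real.pi)
    refine (((hψ.cos.div hψ.sin hs).add
      ((hasDerivAt_id x).const_mul P)).congr_deriv ?_).hasDerivWithinAt
    have e : Real.sin (ψ x) ^ 2 = Real.sin (ψ x - n * Real.pi) ^ 2 := by
      have : ((-1 : ℝ) ^ n) ^ 2 = 1 := by
        rw [← zpow_natCast, ← zpow_mul, mul_comm n, zpow_mul]; simp
      rw [Real.sin_sub_int_mul_pi, mul_pow, this, one_mul]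
    rw [e]
    field_simp
    linear_combination (-P * Real.sin (ψ x - n * Real.pi) ^ 2) *
      Real.sin_sq_add_cos_sq (ψ x - n * Real.pi)
  have hconst := (convex_Icc (0 : ℝ) 1).norm_image_sub_le_of_norm_hasDerivWithin_le (C := 0) hd
    (fun x _ => by simp) h0 h1
  rw [zero_mul, norm_le_zero_iff] at hconst
  have c0 := hcot _ (hP2.trans_le (hx0 0 h0)) (by linarith [hx1 0 h0])
  have c1 := hcot _ (hP2.trans (hx1 1 h1)) (by linarith [hx0 1 h1])
  rw [Real.cos_pi_sub, Real.sin_pi_sub, neg_div] at c1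
  have d0 : 1 / (ψ 0 - n * Real.pi) ≤ P / 2 := by
    rw [← one_div_div 2 P]
    exact one_div_le_one_div_of_le hP2 (hx0 0 h0)
  have d1 : 1 / (Real.pi - (ψ 1 - n * Real.pi)) ≤ P / 2 := by
    rw [← one_div_div 2 P]
    exact one_div_le_one_div_of_le hP2 (hx1 1 h1).le
  linarith

end ScaledAngle

/-! ### Two-sided bounds for the total angle -/

section Asymptotics

variable {N : ℕ} {a : Fin (N + 2) → ℝ} {M : Fin N → ℝ} {Q : Fin (N + 1) → ℝ → ℝ}

theorem exists_scaledAngle_segmentAngle_sub_le (ha : StrictMono a)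
    (hQ : ∀ j, Continuous (Q j)) : ∃ B, 0 ≤ B ∧ ∀ (j : Fin (N + 1)) (k : ℝ), 0 < k → ∀ α,
      |scaledAngle k (segmentAngle a Q j (k ^ 2) α) - scaledAngle k α - k * len a j| ≤ B / k := by
  obtain ⟨B, hB0, hB⟩ := exists_abs_le a hQ
  have hl : ∀ j, 0 ≤ len a j := fun j => sub_nonneg.2 (ha (Fin.castSucc_lt_succ (i := j))).le
  refine ⟨B * ∑ j, len a j, mul_nonneg hB0 (Finset.sum_nonneg fun j _ => hl j),
    fun j k hk α => ?_⟩
  obtain ⟨θ, h, s, t⟩ := exists_isAngle_segmentAngle ha hQ j (k ^ 2) α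
  have := h.abs_scaledAngle_sub_le hk (ha (Fin.castSucc_lt_succ (i := j))).le (hB j)
  rw [s, t] at this
  refine this.trans ?_
  rw [mul_div_right_comm]
  exact mul_le_mul_of_nonneg_left
    (Finset.single_le_sum (f := len a) (fun j _ => hl j) (Finset.mem_univ j)) (by positivity)

/-- Upper bound for the total angle by the number of half-waves that fit into the subintervals. -/
theorem exists_totalAngle_lt (ha : StrictMono a) (hM : ∀ j, 0 < M j)
    (hQ : ∀ j, Continuous (Q j)) : ∃ C, 0 ≤ C ∧ ∀ k, 0 < k → ∀ n : Fin (N + 1) → ℤ,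
      (∀ j, k * len a j + C / k < (n j + 1) * Real.pi) →
      totalAngle a M Q (k ^ 2) < (∑ j, (n j + 1) : ℤ) * Real.pi := by
  obtain ⟨B, hB0, hB⟩ := exists_scaledAngle_segmentAngle_sub_le ha hQ
  refine ⟨B, hB0, fun k hk n hn => ?_⟩
  have hS := strictMono_scaledAngle hk
  have hSπ : ∀ m : ℤ, scaledAngle k (m * Real.pi) = m * Real.pi := fun m =>
    scaledAngle_of_sin_eq_zero (Real.sin_int_mul_pi m)
  have seg : ∀ (j : Fin (N + 1)) (m : ℤ) (α : ℝ), α ≤ m * Real.pi →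
      -- Scaling is increasing and fixes multiples of `π`, so comparisons with them pass between
      -- scaled and unscaled angles.
      segmentAngle a Q j (k ^ 2) α < (m + (n j + 1) : ℤ) * Real.pi := fun j m α hα => by
    have h1 := (abs_le.1 (hB j k hk α)).2
    have h2 := hS.monotone hα
    rw [hSπ] at h2
    rw [← hS.lt_iff_lt, hSπ]
    push_cast
    linarith [hn j]
  -- Extension by zero lets partial sums over `Finset.range` follow the induction over nodes.
  let n' : ℕ → ℤ := fun i => if h : i < N + 1 then n ⟨i, h⟩ else 0
  have hn' : ∀ j : Fin (N + 1), n' j = n j := fun j => dif_pos j.2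
  have hentry : ∀ j : Fin (N + 1), entryAngle a M Q (k ^ 2) j ≤
      (∑ i ∈ Finset.range j, (n' i + 1) : ℤ) * Real.pi := by
    intro j
    induction j using Fin.induction with
    | zero => simp
    | succ j ih =>
      have h1 := seg j.castSucc _ _ ih
      rw [entryAngle_succ, Fin.val_succ, Finset.sum_range_succ]
      rw [← hn', Fin.val_castSucc] at h1
      exact (massAngle_mono (hM j).le le_rfl h1.le).trans_eq
        (massAngle_of_sin_eq_zero (Real.sin_int_mul_pi _))
  have h := seg (Fin.last N) _ _ (hentry (Fin.last N))
  have e : (∑ j, (n j + 1) : ℤ) = ∑ i ∈ Finset.range (N + 1), (n' i + 1) := by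
    rw [← Fin.sum_univ_eq_sum_range]
    simp [hn']
  rw [e, Finset.sum_range_succ]
  rwa [← hn', Fin.val_last] at h

/-- Lower bound for the total angle by the number of half-waves that fit into the subintervals. -/
theorem exists_le_totalAngle (ha : StrictMono a) (hM : ∀ j, 0 < M j)
    (hQ : ∀ j, Continuous (Q j)) : ∃ C, 0 ≤ C ∧ ∀ k, 0 < k → ∀ n : Fin (N + 1) → ℤ,
      (∀ j, n j * Real.pi ≤ k * len a j - C / k) →
      (N + ∑ j, n j : ℤ) * Real.pi ≤ totalAngle a M Q (k ^ 2) := by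
  obtain ⟨B, hB0, hB⟩ := exists_scaledAngle_segmentAngle_sub_le ha hQ
  let R := ∑ j, 2 / M j
  have hM2 : ∀ j, 0 < 2 / M j := fun j => div_pos two_pos (hM j)
  have hR0 : 0 ≤ R := Finset.sum_nonneg fun j _ => (hM2 j).le
  have hR : ∀ j, 2 / M j ≤ R := fun j =>
    Finset.single_le_sum (f := fun j => 2 / M j) (fun j _ => (hM2 j).le) (Finset.mem_univ j)
  -- One `R / k` pays for the deficit left by the previous mass, one for the surplus required before
  -- the next mass, and `B / k` for the error on the segment.
  refine ⟨2 * R + B, by positivity, fun k hk n hn => ?_⟩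
  have hS := strictMono_scaledAngle hk
  have hSπ : ∀ m : ℤ, scaledAngle k (m * Real.pi) = m * Real.pi := fun m =>
    scaledAngle_of_sin_eq_zero (Real.sin_int_mul_pi m)
  have seg : ∀ (j : Fin (N + 1)) (m : ℤ) (α : ℝ), m * Real.pi - R / k ≤ scaledAngle k α →
      (m + n j : ℤ) * Real.pi + R / k ≤ scaledAngle k (segmentAngle a Q j (k ^ 2) α) :=
    fun j m α hα => by
    have h1 := (abs_le.1 (hB j k hk α)).1
    have h2 := hn j
    have h3 : (2 * R + B) / k = R / k + R / k + B / k := by ring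
    push_cast
    linarith
  -- A surplus of `R / k` over a multiple of `π` becomes a deficit of at most `R / k` to the next
  -- one: each mass gains a full `π`.
  have mass : ∀ (j : Fin N) (m : ℤ) (α : ℝ), m * Real.pi + R / k ≤ scaledAngle k α →
      (m + 1 : ℤ) * Real.pi - R / k ≤ scaledAngle k (massAngle (M j) (k ^ 2) α) := by
    intro j m α hα
    obtain ⟨θ, h, s, t⟩ := exists_isAngle_massAngle (M j) (k ^ 2) α
    have hP : 2 / (k * M j) ≤ R / k := by
      rw [mul_comm, ← div_div]
      exact div_le_div_of_nonneg_right (hR j) hk.le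
    have := (h.scaledAngle hk).le_of_large (mul_pos hk (hM j)) m (by rw [s]; linarith)
    rw [t] at this
    push_cast
    linarith
  let n' : ℕ → ℤ := fun i => if h : i < N + 1 then n ⟨i, h⟩ else 0
  have hn' : ∀ j : Fin (N + 1), n' j = n j := fun j => dif_pos j.2
  have hentry : ∀ j : Fin (N + 1), (∑ i ∈ Finset.range j, (n' i + 1) : ℤ) * Real.pi - R / k ≤
      scaledAngle k (entryAngle a M Q (k ^ 2) j) := by
    intro j
    induction j using Fin.induction with
    | zero =>
      have h0 : scaledAngle k 0 = 0 := scaledAngle_of_sin_eq_zero Real.sin_zero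
      have : 0 ≤ R / k := by positivity
      simp [h0, this]
    | succ j ih =>
      have h1 := mass j _ _ (seg j.castSucc _ _ ih)
      rw [entryAngle_succ, Fin.val_succ, Finset.sum_range_succ]
      rw [← hn', Fin.val_castSucc, add_assoc] at h1
      exact h1
  have h := seg (Fin.last N) _ _ (hentry (Fin.last N))
  have e : (N + ∑ j, n j : ℤ) = ∑ i ∈ Finset.range N, (n' i + 1) + n' N := by
    have : ∑ j, n j = ∑ i ∈ Finset.range (N + 1), n' i := by
      rw [← Fin.sum_univ_eq_sum_range]
      simp [hn']
    rw [this, Finset.sum_range_succ, Finset.sum_add_distrib]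
    simp
    ring
  rw [← hn', Fin.val_last, ← e] at h
  rw [← hS.le_iff_le, hSπ]
  have : 0 ≤ R / k := by positivity
  exact le_trans (by linarith) h

theorem exists_le_totalAngle_of_nat (ha : StrictMono a) (hM : ∀ j, 0 < M j)
    (hQ : ∀ j, Continuous (Q j)) (n : ℕ) : ∃ μ, (n + 1) * Real.pi ≤ totalAngle a M Q μ := by
  obtain ⟨C, hC0, hC⟩ := exists_le_totalAngle ha hM hQ
  have hl : ∀ j, 0 < len a j := fun j => sub_pos.2 (ha (Fin.castSucc_lt_succ (i := j)))
  have hev : ∀ j, ∀ᶠ k : ℝ in atTop, ((n + 1 : ℤ) : ℝ) * Real.pi ≤ k * len a j - C / k := by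
    intro j
    have : Tendsto (fun k : ℝ => k * len a j - C / k) atTop atTop := by
      have h1 : Tendsto (fun k : ℝ => k * len a j) atTop atTop :=
        tendsto_id.atTop_mul_const (hl j)
      have h2 : Tendsto (fun k : ℝ => -(C / k)) atTop (𝓝 0) := by
        simpa using (tendsto_id.const_div_atTop C).neg
      simpa only [sub_eq_add_neg] using h1.atTop_add h2
    exact this.eventually_ge_atTop _
  obtain ⟨k, hk, hk0⟩ := ((eventually_all.2 hev).and (eventually_gt_atTop 0)).exists
  refine ⟨k ^ 2, le_trans ?_ (hC k hk0 (fun _ => n + 1) hk)⟩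
  apply mul_le_mul_of_nonneg_right _ Real.pi_pos.le
  simp only [Finset.sum_const, Finset.card_univ, Fintype.card_fin]
  push_cast
  rw [nsmul_eq_mul]
  push_cast
  have : (0 : ℝ) ≤ N := Nat.cast_nonneg N
  have : (0 : ℝ) ≤ n := Nat.cast_nonneg n
  nlinarith

/-- The `n`-th eigenvalue is the parameter at which the total angle equals `(n + 1) π`. -/
theorem exists_totalAngle_eq (ha : StrictMono a) (hM : ∀ j, 0 < M j)
    (hQ : ∀ j, Continuous (Q j)) (n : ℕ) : ∃ μ, totalAngle a M Q μ = (n + 1) * Real.pi := by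
  obtain ⟨μ₁, h₁⟩ := exists_totalAngle_lt_pi ha hM hQ
  obtain ⟨μ₂, h₂⟩ := exists_le_totalAngle_of_nat ha hM hQ n
  refine mem_range_of_exists_le_of_exists_ge (continuous_totalAngle ha hQ) ⟨μ₁, ?_⟩ ⟨μ₂, h₂⟩
  have : (0 : ℝ) ≤ n * Real.pi := by positivity
  linarith

/-! ### Comparison with the sorted clamped frequencies -/

/-- Frequencies of the subintervals with clamped ends. -/
noncomputable def clampedFrequency (a : Fin (N + 2) → ℝ) (p : (_ : Fin (N + 1)) × ℕ) : ℝ :=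
  Real.pi * (p.2 + 1) / len a p.1

theorem clampedFrequency_le_iff (ha : StrictMono a) {y : ℝ} (hy : 0 ≤ y)
    (p : (_ : Fin (N + 1)) × ℕ) :
    clampedFrequency a p ≤ y ↔ p.2 < ⌊y * len a p.1 / Real.pi⌋₊ := by
  have hl : 0 < len a p.1 := sub_pos.2 (ha (Fin.castSucc_lt_succ (i := p.1)))
  rw [clampedFrequency, div_le_iff₀ hl, ← Nat.add_one_le_iff, Nat.le_floor_iff (by positivity),
    le_div_iff₀ Real.pi_pos]
  push_cast
  rw [mul_comm]

/-- The clamped frequencies not exceeding `y`. -/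
noncomputable def clampedBelow (a : Fin (N + 2) → ℝ) (y : ℝ) :
    Finset ((_ : Fin (N + 1)) × ℕ) :=
  Finset.univ.sigma fun j => Finset.range ⌊y * len a j / Real.pi⌋₊

theorem mem_clampedBelow (ha : StrictMono a) {y : ℝ} (hy : 0 ≤ y)
    (p : (_ : Fin (N + 1)) × ℕ) : p ∈ clampedBelow a y ↔ clampedFrequency a p ≤ y := by
  rw [clampedFrequency_le_iff ha hy]
  simp [clampedBelow]

theorem card_clampedBelow (a : Fin (N + 2) → ℝ) (y : ℝ) :
    (clampedBelow a y).card = ∑ j, ⌊y * len a j / Real.pi⌋₊ := by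
  simp [clampedBelow]

theorem clampedFrequency_pos (ha : StrictMono a) (p : (_ : Fin (N + 1)) × ℕ) :
    0 < clampedFrequency a p := by
  have hl : 0 < len a p.1 := sub_pos.2 (ha (Fin.castSucc_lt_succ (i := p.1)))
  rw [clampedFrequency]
  have := Real.pi_pos
  positivity

theorem finite_clampedFrequency_le (ha : StrictMono a) (y : ℝ) :
    {p | clampedFrequency a p ≤ y}.Finite := by
  rcases lt_or_ge y 0 with h | h
  · convert Set.finite_empty
    ext p
    simpa using h.trans (clampedFrequency_pos ha p)
  · refine (clampedBelow a y).finite_toSet.subset fun p hp => ?_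
    exact (mem_clampedBelow ha h p).2 hp

/-- After dropping the first `N` eigenvalues, the frequencies are asymptotically the sorted
clamped frequencies. -/
theorem exists_abs_sqrt_sub_le (ha : StrictMono a) (hM : ∀ j, 0 < M j)
    (hQ : ∀ j, Continuous (Q j)) {μ : ℕ → ℝ}
    (hμ : ∀ n, totalAngle a M Q (μ n) = (n + 1) * Real.pi)
    {e : ℕ ≃ (_ : Fin (N + 1)) × ℕ} (he : Monotone (clampedFrequency a ∘ e)) :
    ∃ (C : ℝ) (n₀ : ℕ), ∀ n ≥ n₀, 0 ≤ μ (n + N) ∧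
      |√(μ (n + N)) - clampedFrequency a (e n)| ≤ C / clampedFrequency a (e n) := by
  obtain ⟨C₁, hC₁0, hC₁⟩ := exists_totalAngle_lt ha hM hQ
  obtain ⟨C₂, hC₂0, hC₂⟩ := exists_le_totalAngle ha hM hQ
  have hΘ := strictMono_totalAngle ha hM hQ
  have hl : ∀ j, 0 < len a j := fun j => sub_pos.2 (ha (Fin.castSucc_lt_succ (i := j)))
  have hπ := Real.pi_pos
  -- Chosen so that shifting a frequency `y` by `D / y` changes each `y ℓ_j` by at least the error
  -- terms `C₁ / y` and `C₂ / y`.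
  let D := ∑ j, (C₁ + C₂) / len a j
  have hDj : ∀ j, 0 ≤ (C₁ + C₂) / len a j := fun j => by have := hl j; positivity
  have hD0 : 0 ≤ D := Finset.sum_nonneg fun j _ => hDj j
  have hD : ∀ j, C₁ + C₂ ≤ D * len a j := fun j => by
    rw [← div_le_iff₀ (hl j)]
    exact Finset.single_le_sum (f := fun j => (C₁ + C₂) / len a j) (fun j _ => hDj j)
      (Finset.mem_univ j)
  obtain ⟨n₀, hn₀⟩ := exists_nat_gt (totalAngle a M Q 1 / Real.pi)
  refine ⟨D * (1 + D), n₀, fun n hn => ?_⟩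
  set x := √(μ (n + N)) with hx
  set ν := clampedFrequency a (e n) with hν
  have hν0 : 0 < ν := clampedFrequency_pos ha _
  have hμ1 : 1 < μ (n + N) := by
    rw [← hΘ.lt_iff_lt, hμ]
    rw [div_lt_iff₀ hπ] at hn₀
    refine hn₀.trans_le (mul_le_mul_of_nonneg_right ?_ hπ.le)
    have : (n₀ : ℝ) ≤ n := by exact_mod_cast hn
    push_cast
    linarith [(Nat.cast_nonneg N : (0 : ℝ) ≤ N)]
  have hx1 : 1 ≤ x := Real.one_le_sqrt.2 hμ1.le
  have hx0 : 0 < x := by linarith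
  have hx2 : x ^ 2 = μ (n + N) := Real.sq_sqrt (by linarith)
  -- Otherwise at most `n` clamped frequencies lie below `x + D / x`. The upper bound adds one `π`
  -- per subinterval, so the total angle at `x²` would be less than `(n + N + 1) π`, its actual
  -- value.
  have upper : ν ≤ x + D / x := by
    by_contra hcon
    rw [not_le] at hcon
    have hy0 : 0 ≤ x + D / x := by positivity
    have h := hC₁ x hx0 (fun j => ⌊(x + D / x) * len a j / Real.pi⌋₊) (fun j => by
      have h1 := Nat.lt_floor_add_one ((x + D / x) * len a j / Real.pi)
      rw [div_lt_iff₀ hπ] at h1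
      push_cast
      refine lt_of_le_of_lt ?_ h1
      have h2 : C₁ / x ≤ D / x * len a j := by
        rw [div_mul_eq_mul_div]
        exact div_le_div_of_nonneg_right (by linarith [hD j]) hx0.le
      linarith)
    rw [hx2, hμ] at h
    have h3 := lt_of_mul_lt_mul_right h hπ.le
    have hcard : (clampedBelow a (x + D / x)).card ≤ n := by
      rw [← Finset.card_range n, ← Finset.card_map e.symm.toEmbedding]
      refine Finset.card_le_card fun i hi => ?_
      obtain ⟨p, hp, rfl⟩ := Finset.mem_map.1 hi
      rw [mem_clampedBelow ha hy0] at hp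
      rw [Finset.mem_range]
      by_contra hge
      have := he (not_lt.1 hge)
      simp only [Function.comp_apply, Equiv.coe_toEmbedding, Equiv.apply_symm_apply] at this
      linarith
    rw [card_clampedBelow] at hcard
    rw [Finset.sum_add_distrib] at h3
    simp only [Finset.sum_const, Finset.card_univ, Fintype.card_fin] at h3
    have hcard' : ((∑ j, ⌊(x + D / x) * len a j / Real.pi⌋₊ : ℕ) : ℝ) ≤ n := by
      exact_mod_cast hcard
    push_cast at h3 hcard'
    simp at h3
    linarith
  -- At least `n + 1` clamped frequencies are at most `ν`, and the masses add `N`, so the total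
  -- angle has reached `(n + N + 1) π` at `(ν + D / ν)²`.
  have lower : x ≤ ν + D / ν := by
    have hy0 : 0 < ν + D / ν := by positivity
    have h := hC₂ (ν + D / ν) hy0 (fun j => ⌊ν * len a j / Real.pi⌋₊) (fun j => by
      have h1 := Nat.floor_le (a := ν * len a j / Real.pi) (by have := hl j; positivity)
      rw [le_div_iff₀ hπ] at h1
      push_cast
      have h2 : C₂ / (ν + D / ν) ≤ C₂ / ν :=
        div_le_div_of_nonneg_left hC₂0 hν0 (le_add_of_nonneg_right (by positivity))
      have h3 : C₂ / ν ≤ D / ν * len a j := by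
        rw [div_mul_eq_mul_div]
        exact div_le_div_of_nonneg_right (by linarith [hD j]) hν0.le
      linarith)
    have hcard : n + 1 ≤ (clampedBelow a ν).card := by
      rw [← Finset.card_range (n + 1), ← Finset.card_map e.toEmbedding]
      refine Finset.card_le_card fun p hp => ?_
      obtain ⟨i, hi, rfl⟩ := Finset.mem_map.1 hp
      rw [mem_clampedBelow ha hν0.le]
      exact he (Nat.lt_succ_iff.1 (Finset.mem_range.1 hi))
    rw [card_clampedBelow] at hcard
    have hcard' : ((n + 1 : ℕ) : ℝ) ≤ (∑ j, ⌊ν * len a j / Real.pi⌋₊ : ℕ) := by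
      exact_mod_cast hcard
    have h4 : totalAngle a M Q (μ (n + N)) ≤ totalAngle a M Q ((ν + D / ν) ^ 2) := by
      rw [hμ]
      refine le_trans (mul_le_mul_of_nonneg_right ?_ hπ.le) h
      push_cast at hcard' ⊢
      linarith
    have h5 := hΘ.le_iff_le.1 h4
    rw [hx]
    exact Real.sqrt_le_iff.2 ⟨hy0.le, h5⟩
  refine ⟨by linarith, abs_le.2 ⟨?_, ?_⟩⟩
  · have h1 : D / x ≤ D := div_le_self hD0 hx1
    -- Since `x ≥ 1`, the error `D / x` can be expressed through `ν`; this is the source of the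
    -- factor `1 + D`.
    have h2 : ν ≤ (1 + D) * x := by nlinarith
    have h3 : D / x ≤ D * (1 + D) / ν := by
      rw [div_le_div_iff₀ hx0 hν0]
      nlinarith
    linarith
  · have : D / ν ≤ D * (1 + D) / ν := div_le_div_of_nonneg_right (by nlinarith) hν0.le
    linarith

end Asymptotics

/-! ### Sorting, permutations and signed indices -/

/-- A countably infinite family of reals with finite sublevel sets can be sorted. -/
theorem exists_equiv_nat_monotone {α : Type*} [Countable α] [Infinite α] (f : α → ℝ)
    (hf : ∀ y, {x | f x ≤ y}.Finite) : ∃ e : ℕ ≃ α, Monotone (f ∘ e) := by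
  classical
  obtain ⟨g, hg⟩ := exists_injective_nat α
  -- Ties of `f`, which occur when clamped frequencies of different subintervals coincide, are
  -- broken by an injective numbering.
  let key : α → ℝ ×ₗ ℕ := fun x => toLex (f x, g x)
  have hkey : Function.Injective key := fun x y h =>
    hg (congrArg Prod.snd (toLex.injective h))
  have hkf : ∀ x y, f x < f y → key x < key y := fun x y h => Prod.Lex.toLex_lt_toLex.2 (Or.inl h)
  have hfin : ∀ x, {y | key y < key x}.Finite := fun x => (hf (f x)).subset fun y hy => by
    by_contra h
    exact lt_asymm hy (hkf x y (not_le.1 h))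
  let rank : α → ℕ := fun x => {y | key y < key x}.ncard
  have hrank : ∀ x y, key x < key y → rank x < rank y := fun x y h =>
    ncard_lt_ncard ⟨fun z hz => lt_trans hz h, fun hs => lt_irrefl (key x) (hs h)⟩ (hfin y)
  have hinj : Function.Injective rank := fun x y h => by
    rcases lt_trichotomy (key x) (key y) with h' | h' | h'
    · exact absurd h (hrank x y h').ne
    · exact hkey h'
    · exact absurd h (hrank y x h').ne'
  have : Infinite (range rank) := infinite_coe_iff.2 (infinite_range_of_injective hinj)
  let o := Nat.Subtype.orderIsoOfNat (range rank)
  refine ⟨o.toEquiv.trans (Equiv.ofInjective rank hinj).symm, fun i j hij => ?_⟩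
  have hr : ∀ i, rank ((Equiv.ofInjective rank hinj).symm (o i)) = o i := fun i =>
    Equiv.apply_ofInjective_symm hinj (o i)
  by_contra h
  have h1 := hrank _ _ (hkf _ _ (not_le.1 h))
  simp only [Equiv.trans_apply, RelIso.coe_fn_toEquiv, hr] at h1
  exact absurd (o.monotone hij) (not_le.2 h1)

/-- Two finite sets of the same size are exchanged by a permutation with finite support. -/
theorem exists_perm_mem_iff {α : Type*} {S T : Finset α} (h : S.card = T.card) :
    ∃ g : Equiv.Perm α, (∀ x, g x ∈ T ↔ x ∈ S) ∧ {x | g x ≠ x}.Finite := by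
  classical
  let U := S ∪ T
  have hS : ∀ x ∈ S, x ∈ U := fun x hx => Finset.mem_union_left _ hx
  have hT : ∀ x ∈ T, x ∈ U := fun x hx => Finset.mem_union_right _ hx
  let e : {x : {x // x ∈ U} // x.1 ∈ S} ≃ {x : {x // x ∈ U} // x.1 ∈ T} :=
    ((Equiv.subtypeSubtypeEquivSubtype (hS _)).trans (Finset.equivOfCardEq h)).trans
      (Equiv.subtypeSubtypeEquivSubtype (hT _)).symm
  refine ⟨Equiv.Perm.ofSubtype e.extendSubtype, fun x => ?_, U.finite_toSet.subset fun x hx => ?_⟩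
  · by_cases hx : x ∈ U
    · rw [Equiv.Perm.ofSubtype_apply_of_mem _ hx]
      by_cases hxS : x ∈ S
      · simpa [hxS] using e.extendSubtype_mem ⟨x, hx⟩ hxS
      · simpa [hxS] using e.extendSubtype_not_mem ⟨x, hx⟩ hxS
    · rw [Equiv.Perm.ofSubtype_apply_of_not_mem _ hx]
      exact ⟨fun h => absurd (hT x h) hx, fun h => absurd (hS x h) hx⟩
  · by_contra h
    exact hx (Equiv.Perm.ofSubtype_apply_of_not_mem _ h)

/-- A nonzero integer as a sign and a natural number. -/
def signEquiv : NonzeroInt ≃ Bool × ℕ where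
  toFun n := (decide (0 < n.1), n.1.natAbs - 1)
  invFun p := ⟨if p.1 then (p.2 + 1 : ℤ) else -(p.2 + 1 : ℤ), by split_ifs <;> omega⟩
  left_inv n := by
    obtain ⟨n, hn⟩ := n
    by_cases h : 0 < n
    · simp only [h, decide_true, if_true, Subtype.mk.injEq]; omega
    · simp only [h, decide_false, Bool.false_eq_true, if_false, Subtype.mk.injEq]; omega
  right_inv p := by
    obtain ⟨b, k⟩ := p
    cases b
    · simp only [Bool.false_eq_true, if_false, Prod.mk.injEq, decide_eq_false_iff_not]; omega
    · simp only [if_true, Prod.mk.injEq, decide_eq_true_eq]; omega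

theorem eigenfrequency_signEquiv_symm (μ : ℕ → ℝ) (b : Bool) (k : ℕ) :
    eigenfrequency μ (signEquiv.symm (b, k)) =
      if b then rootOf (μ k) else -rootOf (μ k) := by
  have h : (signEquiv (signEquiv.symm (b, k))) = (b, k) := signEquiv.apply_symm_apply _
  generalize signEquiv.symm (b, k) = n at h
  obtain ⟨rfl, rfl⟩ := Prod.mk.inj h
  simp [eigenfrequency]

/-! ### Splitting the eigenfrequencies into `N + 1` sequences -/

section Reparametrization

variable {N : ℕ} {a : Fin (N + 2) → ℝ}

theorem norm_eigenfrequency_sub {μ : ℕ → ℝ} {n : ℕ} (hμ : 0 ≤ μ n) (j : Fin (N + 1))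
    (b : Bool) (i : ℕ) :
    ‖eigenfrequency μ (signEquiv.symm (b, n)) -
      ((Real.pi * ((signEquiv.symm (b, i)).1 : ℝ) / len a j : ℝ) : ℂ)‖ =
      |√(μ n) - clampedFrequency a ⟨j, i⟩| := by
  rw [eigenfrequency_signEquiv_symm, rootOf, if_pos hμ, ← Real.norm_eq_abs, ← Complex.norm_real]
  cases b
  · rw [← norm_neg]
    congr 1
    simp [signEquiv, clampedFrequency]
    ring
  · congr 1
    simp [signEquiv, clampedFrequency]

theorem abs_signEquiv_symm (b : Bool) (i : ℕ) :
    |((signEquiv.symm (b, i)).1 : ℝ)| = i + 1 := by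
  have : (0 : ℝ) ≤ i + 1 := by positivity
  cases b
  · simp only [signEquiv, Equiv.coe_fn_symm_mk, Bool.false_eq_true, if_false]
    push_cast
    rw [abs_neg, abs_of_nonneg this]
  · simp only [signEquiv, Equiv.coe_fn_symm_mk, if_true]
    push_cast
    rw [abs_of_nonneg this]

/-- The natural deletion removes both eigenfrequencies of each of the first `N` eigenvalues. A
permutation with finite support carries that set to `S`, and the finitely many disturbed terms only
enlarge the constant. -/
theorem exists_reparametrization (ha : StrictMono a) {μ : ℕ → ℝ}
    {e : ℕ ≃ (_ : Fin (N + 1)) × ℕ} {C : ℝ} {n₀ : ℕ}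
    (hC : ∀ n ≥ n₀, 0 ≤ μ (n + N) ∧
      |√(μ (n + N)) - clampedFrequency a (e n)| ≤ C / clampedFrequency a (e n))
    (S : Finset NonzeroInt) (hS : S.card = 2 * N) :
    ∃ σ : Fin (N + 1) × NonzeroInt ≃ {n : NonzeroInt // n ∉ S},
      ∀ j : Fin (N + 1), ∃ C : ℝ, ∀ m : NonzeroInt,
        ‖eigenfrequency μ (σ (j, m)).1 - ((Real.pi * (m.1 : ℝ) / len a j : ℝ) : ℂ)‖ ≤
          C / |(m.1 : ℝ)| := by
  classical
  have hl : ∀ j, 0 < len a j := fun j => sub_pos.2 (ha (Fin.castSucc_lt_succ (i := j)))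
  let S₀ : Finset NonzeroInt :=
    ((Finset.univ : Finset Bool) ×ˢ Finset.range N).map signEquiv.symm.toEmbedding
  have hS₀ : ∀ b k, signEquiv.symm (b, k) ∈ S₀ ↔ k < N := fun b k => by simp [S₀]
  have hcard : S₀.card = S.card := by simp [S₀, hS]
  obtain ⟨g, hg, hgfin⟩ := exists_perm_mem_iff hcard
  -- The position of the clamped frequency in the sorted list. The shift by `N` in `τ` skips the
  -- dropped eigenvalues, and the sign is kept.
  let rank : Fin (N + 1) × NonzeroInt → ℕ := fun x => e.symm ⟨x.1, (signEquiv x.2).2⟩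
  let τ : Fin (N + 1) × NonzeroInt → NonzeroInt := fun x =>
    signEquiv.symm ((signEquiv x.2).1, rank x + N)
  have hτ : ∀ x, τ x ∉ S₀ := fun x => by
    rw [hS₀]; omega
  have hτinj : Function.Injective τ := by
    rintro ⟨j, m⟩ ⟨j', m'⟩ h
    obtain ⟨h1, h2⟩ := Prod.mk.inj (signEquiv.symm.injective h)
    have h3 := e.symm.injective (Nat.add_right_cancel h2)
    have h4 : j = j' := congrArg Sigma.fst h3
    have h5 : (signEquiv m).2 = (signEquiv m').2 := congrArg (fun p => Sigma.snd p) h3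
    exact Prod.ext h4 (signEquiv.injective (Prod.ext h1 h5))
  have hτsurj : ∀ n, n ∉ S₀ → ∃ x, τ x = n := by
    intro n hn
    obtain ⟨⟨b, k⟩, rfl⟩ := signEquiv.symm.surjective n
    rw [hS₀, not_lt] at hn
    refine ⟨((e (k - N)).1, signEquiv.symm (b, (e (k - N)).2)), ?_⟩
    simp only [τ, rank, Equiv.apply_symm_apply, Sigma.eta, Equiv.symm_apply_apply]
    rw [Nat.sub_add_cancel hn]
  let σ : Fin (N + 1) × NonzeroInt ≃ {n : NonzeroInt // n ∉ S} :=
    Equiv.ofBijective (fun x => ⟨g (τ x), fun h => hτ x ((hg _).1 h)⟩) <| by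
      constructor
      · intro x y h
        exact hτinj (g.injective (congrArg Subtype.val h))
      · rintro ⟨n, hn⟩
        obtain ⟨x, hx⟩ := hτsurj (g.symm n) (fun h => hn (by simpa using (hg _).2 h))
        exact ⟨x, Subtype.ext (by simp [hx])⟩
  have hσ : ∀ x, (σ x).1 = g (τ x) := fun _ => rfl
  refine ⟨σ, fun j => ?_⟩
  let F : NonzeroInt → ℝ := fun m =>
    ‖eigenfrequency μ (σ (j, m)).1 - ((Real.pi * (m.1 : ℝ) / len a j : ℝ) : ℂ)‖ * |(m.1 : ℝ)|
  have hgood : ∀ m : NonzeroInt, n₀ ≤ rank (j, m) → g (τ (j, m)) = τ (j, m) →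
      F m ≤ C * len a j / Real.pi := by
    intro m hm hgm
    obtain ⟨⟨b, i⟩, rfl⟩ := signEquiv.symm.surjective m
    obtain ⟨h1, h2⟩ := hC _ hm
    have hr : e (rank (j, signEquiv.symm (b, i))) = ⟨j, i⟩ := by simp [rank]
    have hτe : τ (j, signEquiv.symm (b, i)) =
        signEquiv.symm (b, rank (j, signEquiv.symm (b, i)) + N) := by simp [τ]
    simp only [F]
    rw [hσ, hgm, hτe, norm_eigenfrequency_sub h1, abs_signEquiv_symm]
    rw [hr] at h2
    have hi : (0 : ℝ) < i + 1 := by positivity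
    have := hl j
    refine (mul_le_mul_of_nonneg_right h2 hi.le).trans_eq ?_
    simp only [clampedFrequency]
    field_simp
  have hbad : {m : NonzeroInt | ¬ (n₀ ≤ rank (j, m) ∧ g (τ (j, m)) = τ (j, m))}.Finite := by
    have f1 : {m : NonzeroInt | g (τ (j, m)) ≠ τ (j, m)}.Finite :=
      hgfin.preimage (f := fun m => τ (j, m))
        (fun m _ m' _ h => (Prod.mk.inj (hτinj h)).2)
    have f2 : {m : NonzeroInt | rank (j, m) < n₀}.Finite := by
      have : (((Finset.univ : Finset Bool) ×ˢ Finset.range (n₀ + N)).map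
          signEquiv.symm.toEmbedding : Set NonzeroInt).Finite := Finset.finite_toSet _
      refine (this.preimage (f := fun m => τ (j, m))
        (fun m _ m' _ h => (Prod.mk.inj (hτinj h)).2)).subset fun m hm => ?_
      simpa [τ] using hm
    refine (f1.union f2).subset fun m hm => ?_
    rcases not_and_or.1 hm with h | h
    · exact Or.inr (not_le.1 h)
    · exact Or.inl h
  obtain ⟨K, hK⟩ := (hbad.image F).bddAbove
  refine ⟨max K (C * len a j / Real.pi), fun m => ?_⟩
  have hm : 0 < |(m.1 : ℝ)| := abs_pos.2 (by exact_mod_cast m.2)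
  rw [le_div_iff₀ hm]
  by_cases h : n₀ ≤ rank (j, m) ∧ g (τ (j, m)) = τ (j, m)
  · exact (hgood m h.1 h.2).trans (le_max_right _ _)
  · exact (hK ⟨m, h, rfl⟩).trans (le_max_left _ _)

end Reparametrization

theorem range_eq_eigenvalues {N : ℕ} {a : Fin (N + 2) → ℝ} {M : Fin N → ℝ}
    {q Q : Fin (N + 1) → ℝ → ℝ} (ha : StrictMono a) (hM : ∀ j, 0 < M j)
    (hQ : ∀ j, Continuous (Q j)) (hqQ : ∀ j, EqOn (q j) (Q j) (Icc (a j.castSucc) (a j.succ)))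
    {μ : ℕ → ℝ} (hμ : ∀ n, totalAngle a M Q (μ n) = (n + 1) * Real.pi) :
    range (fun n => (μ n : ℂ)) = eigenvalues a M q := by
  ext z
  rw [mem_eigenvalues_iff ha hM hQ hqQ]
  constructor
  · rintro ⟨n, rfl⟩
    refine ⟨μ n, ?_, rfl⟩
    rw [hμ]
    exact_mod_cast Real.sin_nat_mul_pi (n + 1)
  · rintro ⟨x, hx, rfl⟩
    obtain ⟨m, hm⟩ := Real.sin_eq_zero_iff.1 hx
    -- Positivity of the total angle excludes the multiples `m ≤ 0`, so every eigenvalue has an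
    -- index `m - 1 ≥ 0`.
    have hm0 : 0 < m := by
      have h := totalAngle_pos ha hM hQ x
      rw [← hm] at h
      exact_mod_cast pos_of_mul_pos_left h Real.pi_pos.le
    refine ⟨(m - 1).toNat, ?_⟩
    have h1 : ((((m - 1).toNat : ℕ) : ℤ) : ℝ) = (m : ℝ) - 1 := by
      rw [Int.toNat_of_nonneg (by omega)]; push_cast; ring
    have h2 : totalAngle a M Q (μ (m - 1).toNat) = totalAngle a M Q x := by
      rw [hμ, ← hm, ← Int.cast_natCast, h1]; ring
    simp only [(strictMono_totalAngle ha hM hQ).injective h2]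

end LoadedString

theorem theorem4 (N : ℕ) (a : Fin (N + 2) → ℝ) (ha0 : a 0 = 0) (ha : StrictMono a)
    (M : Fin N → ℝ) (hM : ∀ j, 0 < M j)
    (q : Fin (N + 1) → ℝ → ℝ)
    (hq : ∀ j : Fin (N + 1), ContinuousOn (q j) (Set.Icc (a j.castSucc) (a j.succ))) :
    ∃ μ : ℕ → ℝ, StrictMono μ ∧
      Set.range (fun n => (μ n : ℂ)) = LoadedString.eigenvalues a M q ∧
      ∀ S : Finset LoadedString.NonzeroInt, S.card = 2 * N →
        ∃ σ : Fin (N + 1) × LoadedString.NonzeroInt ≃ {n : LoadedString.NonzeroInt // n ∉ S},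
          ∀ j : Fin (N + 1), ∃ C : ℝ, ∀ m : LoadedString.NonzeroInt,
            ‖LoadedString.eigenfrequency μ (σ (j, m)).1 -
                ((Real.pi * (m.1 : ℝ) / LoadedString.len a j : ℝ) : ℂ)‖ ≤ C / |(m.1 : ℝ)| := by
  have hlt : ∀ j : Fin (N + 1), a j.castSucc ≤ a j.succ := fun j =>
    (ha Fin.castSucc_lt_succ).le
  -- Continuous extensions of the potentials to `ℝ`; the eigenvalues depend only on the values
  -- inside the subintervals.
  let Q : Fin (N + 1) → ℝ → ℝ := fun j =>
    Set.IccExtend (hlt j) ((Set.Icc (a j.castSucc) (a j.succ)).domRestrict (q j))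
  have hQ : ∀ j, Continuous (Q j) := fun j => (hq j).domRestrict.Icc_extend'
  have hqQ : ∀ j, Set.EqOn (q j) (Q j) (Set.Icc (a j.castSucc) (a j.succ)) := fun j x hx => by
    simp only [Q]
    rw [Set.IccExtend_of_mem (hlt j) _ hx]; rfl
  choose μ hμ using LoadedString.exists_totalAngle_eq ha hM hQ
  obtain ⟨e, he⟩ := LoadedString.exists_equiv_nat_monotone (LoadedString.clampedFrequency a)
    (LoadedString.finite_clampedFrequency_le ha)
  obtain ⟨C, n₀, hC⟩ := LoadedString.exists_abs_sqrt_sub_le ha hM hQ hμ he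
  refine ⟨μ, fun m n h => ?_, LoadedString.range_eq_eigenvalues ha hM hQ hqQ hμ,
    fun S hS => LoadedString.exists_reparametrization ha hC S hS⟩
  rw [← (LoadedString.strictMono_totalAngle ha hM hQ).lt_iff_lt, hμ, hμ]
  have : (m : ℝ) < n := by exact_mod_cast h
  exact mul_lt_mul_of_pos_right (by linarith) Real.pi_pos
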